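/- **Setting.** Alice and Bob each sell a copy of a good to one buyer with value $v\ge 0$ for one copy. The value is drawn from a probability distribution $D$ on $[0,\infty)$ with density $f$ and CDF $F$; assume that $\Gamma_D(v)=v(1-F(v))$ attains its maximum over $v\ge 0$, and let $\mathtt v$ be a maximizer. Assume that $D$ is *regular*, i.e. $\varphi_D(v)=v-\frac{1-F(v)}{f(v)}$ is non-decreasing, or has *diminishing marginal revenue* (DMR), i.e. $\varphi_D(v)f(v)=vf(v)-(1-F(v))$ is non-decreasing; both conditions are imposed on $\{v\ge 0: F(v)<1\}$, with $\varphi_D(v)=-\infty$ where $f(v)=0$. A *mechanism* is a proper pricing function $M:[0,1]\to[0,\infty]$: the buyer may receive the good with probability $x$ for an expected payment $M(x)$, where $M(0)=0$, $M$ is non-decreasing, and $M$ is continuous and convex on $[0,\bar x]$ with $\bar x=\sup\{x: M(x)<\infty\}$. The *single-lottery mechanism* with probability $z\in[0,1]$ and price $p\ge 0$ is $M(x)=px$ for $x\le z$ and $M(x)=\infty$ for $x>z$; the *fixed-price mechanism* $\mathsf{FP}_q$ is $M(x)=qx$ on $[0,1]$. Given mechanisms $(A,B)$ of Alice and Bob,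 the buyer, knowing $v$, chooses which seller to approach first and probabilities $x_A,x_B\in[0,1]$ with $A(x_A),B(x_B)<\infty$; the second seller is approached only if the first one did not allocate the good. The expected utility is $x_Av-A(x_A)+(1-x_A)(x_Bv-B(x_B))$ if Alice is first and $x_Bv-B(x_B)+(1-x_B)(x_Av-A(x_A))$ if Bob is first. The buyer maximizes expected utility, breaking ties in favor of a larger expected allocation from Bob and then of a larger expected allocation from Alice. Let $\mathsf{rev}_{\mathsf B,(A,B)}(D)$ be the resulting expected payment to Bob when $v\sim D$. **Lemma.** Let $A$ be the single-lottery mechanism with probability $z\in[0,1]$ and price $p\ge 0$. For every mechanism $B$ of Bob there is $q\ge 0$ with $$\mathsf{rev}_{\mathsf B,(A,B)}(D)\le \mathsf{rev}_{\mathsf B,(A,\mathsf{FP}_q)}(D).$$ Moreover, if $\max_{0\le\hat p\le p}\mathsf{rev}_{\mathsf B,(A,\mathsf{FP}_{\hat p})}(D)<\mathsf{rev}_{\mathsf B,(A,\mathsf{FP}_{\mathtt v})}(D)$ and under $(A,B)$ some type $v\ge p$ makes an expected payment smaller than $pz$ to Alice, then $q$ can be chosen so that the inequality is strict. -/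

import Mathlib

open MeasureTheory ProbabilityTheory Set
open scoped ENNReal

noncomputable section

namespace Duopoly

/-! ### Pricing functions -/

/-- A pricing function: `M x` is the (possibly infinite) expected payment for receiving the good
with probability `x`. Only the values on `[0, 1]` are ever used. -/
abbrev Pricing := ℝ → ℝ≥0∞

/-- The supremum of the probabilities that are offered at a finite price. -/
def maxProb (M : Pricing) : ℝ := sSup {x | x ∈ Icc (0 : ℝ) 1 ∧ M x < ∞}

/-- Proper pricing functions: zero at zero, weakly increasing on `[0, 1]`, continuous and weakly
convex on `[0, maxProb M]`. -/
structure IsProper (M : Pricing) : Prop where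
  map_zero : M 0 = 0
  monotoneOn : MonotoneOn M (Icc 0 1)
  continuousOn : ContinuousOn M (Icc 0 (maxProb M))
  convex : ∀ x ∈ Icc 0 (maxProb M), ∀ y ∈ Icc 0 (maxProb M), ∀ t ∈ Icc (0 : ℝ) 1,
    M (t * x + (1 - t) * y) ≤ ENNReal.ofReal t * M x + ENNReal.ofReal (1 - t) * M y

/-- The single-lottery mechanism with probability `z` and price `p`. -/
def singleLottery (z p : ℝ) : Pricing := fun x => if x ≤ z then ENNReal.ofReal (p * x) else ∞

/-- The fixed-price mechanism with price `q`. -/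
def fixedPrice (q : ℝ) : Pricing := fun x => ENNReal.ofReal (q * x)

/-! ### The buyer -/

inductive Seller
  | alice
  | bob

/-- A buyer strategy: the seller approached first, the probability bought from Alice and the
probability bought from Bob; the purchase from the second seller is made only if the first seller
did not allocate the good. -/
structure Strategy where
  first : Seller
  xA : ℝ
  xB : ℝ

/-- The strategy uses probabilities that are offered at a finite price. -/
def Feasible (A B : Pricing) (σ : Strategy) : Prop :=
  (σ.xA ∈ Icc (0 : ℝ) 1 ∧ A σ.xA ≠ ∞) ∧ (σ.xB ∈ Icc (0 : ℝ) 1 ∧ B σ.xB ≠ ∞)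

/-- Expected utility of a buyer with value `v` (for feasible strategies). -/
def utility (A B : Pricing) (v : ℝ) (σ : Strategy) : ℝ :=
  match σ.first with
  | .alice => (σ.xA * v - (A σ.xA).toReal) + (1 - σ.xA) * (σ.xB * v - (B σ.xB).toReal)
  | .bob => (σ.xB * v - (B σ.xB).toReal) + (1 - σ.xB) * (σ.xA * v - (A σ.xA).toReal)

/-- Expected allocation from Alice. -/
def allocA (σ : Strategy) : ℝ :=
  match σ.first with
  | .alice => σ.xA
  | .bob => (1 - σ.xB) * σ.xA

/-- Expected allocation from Bob. -/
def allocB (σ : Strategy) : ℝ :=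
  match σ.first with
  | .alice => (1 - σ.xA) * σ.xB
  | .bob => σ.xB

/-- Expected payment to Alice. -/
def payA (A : Pricing) (σ : Strategy) : ℝ≥0∞ :=
  match σ.first with
  | .alice => A σ.xA
  | .bob => ENNReal.ofReal (1 - σ.xB) * A σ.xA

/-- Expected payment to Bob. -/
def payB (B : Pricing) (σ : Strategy) : ℝ≥0∞ :=
  match σ.first with
  | .alice => ENNReal.ofReal (1 - σ.xA) * B σ.xB
  | .bob => B σ.xB

/-- The strategy `σ` is an equilibrium choice of a buyer with value `v`: it is feasible and
maximizes expected utility, ties being broken first in favor of a larger expected allocation from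
Bob and then in favor of a larger expected allocation from Alice. -/
def IsChoice (A B : Pricing) (v : ℝ) (σ : Strategy) : Prop :=
  Feasible A B σ ∧ ∀ τ, Feasible A B τ →
    utility A B v τ < utility A B v σ ∨
      (utility A B v τ = utility A B v σ ∧
        (allocB τ < allocB σ ∨ (allocB τ = allocB σ ∧ allocA τ ≤ allocA σ)))

open Classical in
/-- The strategy chosen by a buyer with value `v`. Against a single-lottery mechanism of Alice and
a proper mechanism of Bob such a choice exists, and any two choices involve the same payments. -/
def choice (A B : Pricing) (v : ℝ) : Strategy :=
  if h : ∃ σ, IsChoice A B v σ then h.choose else ⟨.bob, 0, 0⟩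

/-- Bob's expected revenue when the buyer's value has law `D`. -/
def revB (A B : Pricing) (D : Measure ℝ) : ℝ≥0∞ := ∫⁻ v, payB B (choice A B v) ∂D

/-! ### The value distribution -/

/-- `D` is a probability distribution of values `v ≥ 0` with density `f`. -/
structure IsValueDistribution (D : Measure ℝ) (f : ℝ → ℝ) : Prop where
  isProbabilityMeasure : IsProbabilityMeasure D
  measurable : Measurable f
  nonneg : ∀ v, 0 ≤ f v
  eq_withDensity : D = volume.withDensity fun v => ENNReal.ofReal (f v)
  nonneg_values : D (Iio 0) = 0

/-- The revenue curve `v (1 - F v)`. -/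
def revenueCurve (D : Measure ℝ) (v : ℝ) : ℝ := v * (1 - cdf D v)

/-- `v` is a monopolist revenue-maximizing (Myerson) price. -/
def IsMyersonPrice (D : Measure ℝ) (v : ℝ) : Prop :=
  0 ≤ v ∧ IsMaxOn (revenueCurve D) (Ici 0) v

/-- The types below the upper end of the support, where the regularity conditions are imposed. -/
def typeRange (D : Measure ℝ) : Set ℝ := {v | 0 ≤ v ∧ cdf D v < 1}

/-- The virtual value `v - (1 - F v) / f v`; it is `-∞` where `f v = 0` and `F v < 1`, because
division in `ℝ≥0∞` of a nonzero number by zero is `∞`. -/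
def virtualValue (D : Measure ℝ) (f : ℝ → ℝ) (v : ℝ) : EReal :=
  (v : EReal) - ((ENNReal.ofReal (1 - cdf D v) / ENNReal.ofReal (f v) : ℝ≥0∞) : EReal)

/-- Regularity: the virtual value is non-decreasing. -/
def IsRegular (D : Measure ℝ) (f : ℝ → ℝ) : Prop :=
  MonotoneOn (virtualValue D f) (typeRange D)

/-- Diminishing marginal revenue: virtual value times density, that is `v f(v) - (1 - F v)`, is
non-decreasing. -/
def IsDMR (D : Measure ℝ) (f : ℝ → ℝ) : Prop :=
  MonotoneOn (fun v => v * f v - (1 - cdf D v)) (typeRange D)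

end Duopoly

end

/-!
Against Alice's lottery, a buyer with value `v` behaves like a buyer with the effective value
`s v = v - z * max (v - p) 0` who faces the tariff `min (B x) (z * p * x + (1 - z) * B x)`, the two
branches standing for Bob and Alice being approached first. By incentive compatibility the tariff
paid is the integral, over the units of probability bought, of the lowest effective value at which
a unit is bought. Let `X` be the largest probability bought from Bob at an average price of at most
`p`, and write `R` for the revenue curve. On the units up to `X` Bob earns at most `R p` on average:
by regularity or DMR, the revenue curve has a supporting line at `p`, and the threshold prices of
these units average to at most `p`. On each unit above `X` he earns at most `(1 - z) * R vM`, since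
the buyer plays Alice's lottery first. The bound `X * R p + (1 - X) * (1 - z) * R vM` is a convex
combination of revenues that the fixed prices `p` and `vM` attain.
-/

namespace Duopoly

variable {D : Measure ℝ} {f : ℝ → ℝ} {p t v z : ℝ}

/-! ### Supporting lines of the revenue curve -/

theorem le_of_ae_hasDerivAt_nonpos {g g' : ℝ → ℝ} {a b : ℝ} (hab : a ≤ b)
    (hg : AbsolutelyContinuousOnInterval g a b)
    (hderiv : ∀ᵐ t, t ∈ Icc a b → HasDerivAt g (g' t) t) (hg' : ∀ t ∈ Icc a b, g' t ≤ 0) :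
    g b ≤ g a := by
  have hle : ∫ t in a..b, deriv g t ≤ ∫ _ in a..b, (0 : ℝ) := by
    apply intervalIntegral.integral_mono_ae_restrict hab hg.intervalIntegrable_deriv (by simp)
    rw [Filter.EventuallyLE, ae_restrict_iff' measurableSet_Icc]
    filter_upwards [hderiv] with t ht htab
    rw [(ht htab).deriv]
    exact hg' t htab
  rw [hg.integral_deriv_eq_sub, intervalIntegral.integral_zero] at hle
  exact sub_nonpos.1 hle

namespace IsValueDistribution

theorem nullSingletonClass (hD : IsValueDistribution D f) : NullSingletonClass D := by
  rw [hD.eq_withDensity]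
  infer_instance

theorem ae_nonneg (hD : IsValueDistribution D f) : ∀ᵐ v ∂D, 0 ≤ v := by
  rw [ae_iff]
  simpa only [not_le, Iio_def] using hD.nonneg_values

theorem integrable (hD : IsValueDistribution D f) : Integrable f := by
  have := hD.isProbabilityMeasure
  refine ⟨hD.measurable.aestronglyMeasurable, ?_⟩
  have hmass : D univ = ∫⁻ v, ENNReal.ofReal (f v) := by
    rw [hD.eq_withDensity, withDensity_apply _ MeasurableSet.univ, Measure.restrict_univ]
  rw [hasFiniteIntegral_iff_ofReal (ae_of_all _ hD.nonneg), ← hmass]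
  exact measure_lt_top D univ

theorem measure_Ici (hD : IsValueDistribution D f) (t : ℝ) :
    D (Ici t) = ENNReal.ofReal (1 - cdf D t) := by
  have := hD.isProbabilityMeasure
  have := hD.nullSingletonClass
  rw [← measure_congr (Ioi_ae_eq_Ici (μ := D) (a := t)), ← compl_Iic,
    prob_compl_eq_one_sub measurableSet_Iic, ENNReal.ofReal_sub _ (cdf_nonneg D t), ofReal_cdf,
    ENNReal.ofReal_one]

theorem cdf_zero (hD : IsValueDistribution D f) : cdf D 0 = 0 := by
  have := hD.isProbabilityMeasure
  have := hD.nullSingletonClass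
  rw [cdf_eq_real, Measure.real, ← measure_congr (Iio_ae_eq_Iic (μ := D) (a := (0 : ℝ))),
    hD.nonneg_values, ENNReal.toReal_zero]

theorem cdf_sub_cdf (hD : IsValueDistribution D f) (a b : ℝ) :
    cdf D b - cdf D a = ∫ t in a..b, f t := by
  have := hD.isProbabilityMeasure
  have hcdf : ∀ x, cdf D x = ∫ t in Iic x, f t := fun x => by
    rw [cdf_eq_real, integral_eq_lintegral_of_nonneg_ae (ae_of_all _ hD.nonneg)
      hD.measurable.aestronglyMeasurable, ← withDensity_apply _ measurableSet_Iic,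
      ← hD.eq_withDensity, Measure.real]
  rw [hcdf, hcdf, intervalIntegral.integral_Iic_sub_Iic hD.integrable.integrableOn
    hD.integrable.integrableOn]

theorem cdf_eq_add_integral (hD : IsValueDistribution D f) (a : ℝ) :
    cdf D = fun t => cdf D a + ∫ u in a..t, f u := by
  funext t
  rw [← hD.cdf_sub_cdf, add_sub_cancel]

theorem absolutelyContinuousOnInterval_cdf (hD : IsValueDistribution D f) (a b : ℝ) :
    AbsolutelyContinuousOnInterval (cdf D) a b := by
  rw [hD.cdf_eq_add_integral a]
  have hconst : AbsolutelyContinuousOnInterval (fun _ : ℝ => cdf D a) a b :=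
    (LipschitzWith.const (cdf D a)).lipschitzOnWith.absolutelyContinuousOnInterval
  have hint : IntervalIntegrable f volume a b := hD.integrable.intervalIntegrable
  exact hconst.add
    (hint.absolutelyContinuousOnInterval_intervalIntegral (c := a) left_mem_uIcc)

theorem ae_hasDerivAt_cdf (hD : IsValueDistribution D f) :
    ∀ᵐ t, HasDerivAt (cdf D) (f t) t := by
  rw [hD.cdf_eq_add_integral 0]
  have hint := LocallyIntegrable.ae_hasDerivAt_integral hD.integrable.locallyIntegrable
  filter_upwards [hint] with t ht
  exact (ht 0).const_add _

end IsValueDistribution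

theorem one_sub_cdf_nonneg (D : Measure ℝ) (t : ℝ) : 0 ≤ 1 - cdf D t :=
  sub_nonneg.2 (cdf_le_one D t)

/-- The revenue curve of a seller with unit cost `c`, minus the linear function of slope `l`. -/
noncomputable def tiltedRevenue (D : Measure ℝ) (c l t : ℝ) : ℝ := (t - c) * (1 - cdf D t) - l * t

theorem IsValueDistribution.absolutelyContinuousOnInterval_tiltedRevenue
    (hD : IsValueDistribution D f) (c l a b : ℝ) :
    AbsolutelyContinuousOnInterval (tiltedRevenue D c l) a b := by
  have hsub : AbsolutelyContinuousOnInterval (fun t : ℝ => t - c) a b :=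
    ContDiffOn.absolutelyContinuousOnInterval (by fun_prop)
  have hmul : AbsolutelyContinuousOnInterval (fun t : ℝ => l * t) a b :=
    ContDiffOn.absolutelyContinuousOnInterval (by fun_prop)
  have hone : AbsolutelyContinuousOnInterval (fun _ : ℝ => (1 : ℝ)) a b :=
    ContDiffOn.absolutelyContinuousOnInterval (by fun_prop)
  exact (hsub.fun_mul (hone.fun_sub (hD.absolutelyContinuousOnInterval_cdf a b))).fun_sub hmul

theorem IsValueDistribution.ae_hasDerivAt_tiltedRevenue (hD : IsValueDistribution D f) (c l : ℝ) :
    ∀ᵐ t, HasDerivAt (tiltedRevenue D c l) ((1 - cdf D t) - (t - c) * f t - l) t := by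
  filter_upwards [hD.ae_hasDerivAt_cdf] with t ht
  have h := (((hasDerivAt_id t).sub_const c).fun_mul (ht.const_sub 1)).fun_sub
    ((hasDerivAt_id t).const_mul l)
  refine h.congr_deriv ?_
  simp only [id_eq]
  ring

theorem IsValueDistribution.tiltedRevenue_le_of_derivative_sign (hD : IsValueDistribution D f)
    {c l : ℝ} (hright : ∀ u ∈ Icc p t, (1 - cdf D u) - (u - c) * f u - l ≤ 0)
    (hleft : ∀ u ∈ Icc t p, 0 ≤ (1 - cdf D u) - (u - c) * f u - l) :
    tiltedRevenue D c l t ≤ tiltedRevenue D c l p := by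
  rcases le_total p t with h | h
  · refine le_of_ae_hasDerivAt_nonpos h (hD.absolutelyContinuousOnInterval_tiltedRevenue c l p t)
      ?_ hright
    filter_upwards [hD.ae_hasDerivAt_tiltedRevenue c l] with u hu _ using hu
  · refine neg_le_neg_iff.1 (le_of_ae_hasDerivAt_nonpos (g := fun u => -tiltedRevenue D c l u) h
      (hD.absolutelyContinuousOnInterval_tiltedRevenue c l t p).fun_neg ?_
      fun u hu => neg_nonpos.2 (hleft u hu))
    filter_upwards [hD.ae_hasDerivAt_tiltedRevenue c l] with u hu _ using hu.fun_neg

theorem mem_typeRange_of_le (ht : t ∈ typeRange D) (hp : 0 ≤ p) (hpt : p ≤ t) :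
    p ∈ typeRange D :=
  ⟨hp, (monotone_cdf D hpt).trans_lt ht.2⟩

theorem cdf_eq_one_of_notMem_typeRange (ht : 0 ≤ t) (h : t ∉ typeRange D) : cdf D t = 1 :=
  (cdf_le_one D t).antisymm (not_lt.1 fun hlt => h ⟨ht, hlt⟩)

theorem revenueCurve_nonneg (D : Measure ℝ) (ht : 0 ≤ t) : 0 ≤ revenueCurve D t :=
  mul_nonneg ht (one_sub_cdf_nonneg D t)

theorem mem_typeRange_of_revenueCurve_lt (hp : 0 ≤ p) (ht : 0 ≤ t)
    (hlt : revenueCurve D p < revenueCurve D t) : t ∈ typeRange D := by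
  by_contra h
  have hzero : revenueCurve D t = 0 := by
    rw [revenueCurve, cdf_eq_one_of_notMem_typeRange ht h, sub_self, mul_zero]
  exact absurd (revenueCurve_nonneg D hp) (not_le.2 (hzero ▸ hlt))

/-- The line of slope `l` through the point of the revenue curve at `p` supports the curve from
above on the nonnegative half-line. -/
structure IsSupportingSlope (D : Measure ℝ) (p l : ℝ) : Prop where
  nonneg : 0 ≤ l
  le : ∀ t, 0 ≤ t → revenueCurve D t ≤ revenueCurve D p + l * (t - p)

theorem virtualValue_of_pos (hf : 0 < f t) :
    virtualValue D f t = ((t - (1 - cdf D t) / f t : ℝ) : EReal) := by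
  rw [virtualValue, ← ENNReal.ofReal_div_of_pos hf, EReal.coe_ennreal_ofReal,
    max_eq_left (div_nonneg (one_sub_cdf_nonneg D t) hf.le), EReal.coe_sub]

theorem virtualValue_of_eq_zero (ht : t ∈ typeRange D) (hf : f t = 0) :
    virtualValue D f t = ⊥ := by
  have h : ENNReal.ofReal (1 - cdf D t) ≠ 0 := (ENNReal.ofReal_pos.2 (sub_pos.2 ht.2)).ne'
  rw [virtualValue, hf, ENNReal.ofReal_zero, ENNReal.div_zero h, EReal.coe_ennreal_top,
    EReal.sub_top]

theorem IsRegular.density_pos_of_le (hD : IsValueDistribution D f) (hreg : IsRegular D f)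
    (hp : p ∈ typeRange D) (ht : t ∈ typeRange D) (hpt : p ≤ t) (hf : 0 < f p) : 0 < f t := by
  refine (hD.nonneg t).lt_of_ne fun h => ?_
  have hle := hreg hp ht hpt
  rw [virtualValue_of_eq_zero ht h.symm, virtualValue_of_pos hf] at hle
  exact absurd hle (not_le.2 (EReal.bot_lt_coe _))

theorem IsRegular.virtualValue_le (hD : IsValueDistribution D f) (hreg : IsRegular D f)
    (hp : p ∈ typeRange D) (ht : t ∈ typeRange D) (hpt : p ≤ t) (hf : 0 < f p) :
    p - (1 - cdf D p) / f p ≤ t - (1 - cdf D t) / f t := by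
  have hle := hreg hp ht hpt
  rwa [virtualValue_of_pos hf, virtualValue_of_pos (hreg.density_pos_of_le hD hp ht hpt hf),
    EReal.coe_le_coe_iff] at hle

/-- A seller whose unit cost is the virtual value at `p` maximizes profit at the price `p`. -/
theorem IsRegular.sub_virtualValue_mul_le (hD : IsValueDistribution D f) (hreg : IsRegular D f)
    (hp : p ∈ typeRange D) (hf : 0 < f p) (ht : 0 ≤ t) :
    (t - (p - (1 - cdf D p) / f p)) * (1 - cdf D t) ≤
      (p - (p - (1 - cdf D p) / f p)) * (1 - cdf D p) := by
  by_cases htr : t ∈ typeRange D; swap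
  · rw [cdf_eq_one_of_notMem_typeRange ht htr, sub_self, mul_zero, sub_sub_cancel]
    exact mul_nonneg (div_nonneg (one_sub_cdf_nonneg D p) hf.le) (one_sub_cdf_nonneg D p)
  set c := p - (1 - cdf D p) / f p
  have hright : ∀ u ∈ Icc p t, (1 - cdf D u) - (u - c) * f u - 0 ≤ 0 := fun u hu => by
    have hur := mem_typeRange_of_le htr (hp.1.trans hu.1) hu.2
    have hle : (1 - cdf D u) / f u ≤ u - c := by linarith [hreg.virtualValue_le hD hp hur hu.1 hf]
    rw [div_le_iff₀ (hreg.density_pos_of_le hD hp hur hu.1 hf)] at hle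
    linarith
  have hleft : ∀ u ∈ Icc t p, 0 ≤ (1 - cdf D u) - (u - c) * f u - 0 := fun u hu => by
    rcases (hD.nonneg u).eq_or_lt with hfu | hfu
    · linarith [hfu ▸ mul_zero (u - c), one_sub_cdf_nonneg D u]
    have hur := mem_typeRange_of_le hp (ht.trans hu.1) hu.2
    have hle : u - c ≤ (1 - cdf D u) / f u := by linarith [hreg.virtualValue_le hD hur hp hu.2 hfu]
    rw [le_div_iff₀ hfu] at hle
    linarith
  simpa only [tiltedRevenue, zero_mul, sub_zero] using
    hD.tiltedRevenue_le_of_derivative_sign hright hleft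

theorem IsRegular.cdf_eq_zero (hD : IsValueDistribution D f) (hreg : IsRegular D f)
    (hp : p ∈ typeRange D) (hf : f p = 0) : cdf D p = 0 := by
  have hzero : ∀ u ∈ uIcc 0 p, f u = 0 := fun u hu => by
    rw [uIcc_of_le hp.1] at hu
    by_contra hne
    exact (hreg.density_pos_of_le hD (mem_typeRange_of_le hp hu.1 hu.2) hp hu.2
      ((hD.nonneg u).lt_of_ne' hne)).ne' hf
  have hint := hD.cdf_sub_cdf 0 p
  rwa [hD.cdf_zero, sub_zero, intervalIntegral.integral_congr hzero,
    intervalIntegral.integral_zero] at hint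

/-- The hyperbola `s ↦ (p - c) * G / (s - c)` is a demand curve whose revenue curve is concave when
`c ≤ 0`; the right-hand side is its tangent line at `p`. -/
theorem mul_le_tangent_of_sub_mul_le {c g G : ℝ} (hc : c ≤ 0) (hcp : c < p) (hG : 0 ≤ G)
    (ht : 0 ≤ t) (hle : (t - c) * g ≤ (p - c) * G) :
    t * g ≤ p * G + G * (-c) / (p - c) * (t - p) := by
  have hpc : 0 < p - c := sub_pos.2 hcp
  rw [div_mul_eq_mul_div, ← sub_le_iff_le_add', le_div_iff₀ hpc]
  rcases ht.eq_or_lt with rfl | ht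
  · nlinarith [mul_nonneg hG (sq_nonneg p)]
  have htc : 0 < t - c := by linarith
  have hsq : 0 ≤ G * (-c) * (t - p) ^ 2 := by
    have := neg_nonneg.2 hc
    positivity
  refine le_of_mul_le_mul_right ?_ htc
  nlinarith [mul_le_mul_of_nonneg_left hle (mul_pos ht hpc).le]

theorem IsRegular.exists_isSupportingSlope (hD : IsValueDistribution D f) (hreg : IsRegular D f)
    (hp : 0 ≤ p) (hpv : p ≤ v) (hlt : revenueCurve D p < revenueCurve D v) :
    ∃ l, IsSupportingSlope D p l := by
  have hpr : p ∈ typeRange D :=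
    mem_typeRange_of_le (mem_typeRange_of_revenueCurve_lt hp (hp.trans hpv) hlt) hp hpv
  rcases (hD.nonneg p).eq_or_lt with hf | hf
  · refine ⟨1, zero_le_one, fun t ht => ?_⟩
    simp only [revenueCurve, hreg.cdf_eq_zero hD hpr hf.symm]
    linarith [mul_nonneg ht (cdf_nonneg D t)]
  have hprofit := fun t ht => hreg.sub_virtualValue_mul_le hD hpr hf (t := t) ht
  have hcp : p - (1 - cdf D p) / f p < p := sub_lt_self p (div_pos (sub_pos.2 hpr.2) hf)
  generalize p - (1 - cdf D p) / f p = c at hprofit hcp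
  have hc : c ≤ 0 := by
    by_contra! hc
    have hle := hprofit v (hp.trans hpv)
    have hcdf := mul_le_mul_of_nonneg_left (monotone_cdf D hpv) hc.le
    simp only [revenueCurve] at hlt
    linarith
  exact ⟨(1 - cdf D p) * (-c) / (p - c),
    div_nonneg (mul_nonneg (one_sub_cdf_nonneg D p) (neg_nonneg.2 hc)) (sub_pos.2 hcp).le,
    fun t ht => mul_le_tangent_of_sub_mul_le hc hcp (one_sub_cdf_nonneg D p) ht (hprofit t ht)⟩

theorem IsDMR.revenueCurve_le_tangent (hD : IsValueDistribution D f) (hdmr : IsDMR D f)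
    (hp : p ∈ typeRange D) (ht : t ∈ typeRange D) :
    revenueCurve D t ≤ revenueCurve D p + ((1 - cdf D p) - p * f p) * (t - p) := by
  have h := hD.tiltedRevenue_le_of_derivative_sign (c := 0) (l := (1 - cdf D p) - p * f p)
    (p := p) (t := t) (fun u hu => ?_) (fun u hu => ?_)
  · simp only [tiltedRevenue, sub_zero] at h
    simp only [revenueCurve]
    linarith
  · have := hdmr hp (mem_typeRange_of_le ht (hp.1.trans hu.1) hu.2) hu.1
    simp only at this
    linarith
  · have := hdmr (mem_typeRange_of_le hp (ht.1.trans hu.1) hu.2) hp hu.2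
    simp only at this
    linarith

theorem IsDMR.exists_isSupportingSlope (hD : IsValueDistribution D f) (hdmr : IsDMR D f)
    (hp : 0 ≤ p) (hpv : p ≤ v) (hlt : revenueCurve D p < revenueCurve D v) :
    ∃ l, IsSupportingSlope D p l := by
  have hv : v ∈ typeRange D := mem_typeRange_of_revenueCurve_lt hp (hp.trans hpv) hlt
  have hpr : p ∈ typeRange D := mem_typeRange_of_le hv hp hpv
  have hslope : 0 ≤ (1 - cdf D p) - p * f p := by
    by_contra! hneg
    have := hdmr.revenueCurve_le_tangent hD hpr hv
    nlinarith
  refine ⟨_, hslope, fun t ht => ?_⟩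
  by_cases htr : t ∈ typeRange D
  · exact hdmr.revenueCurve_le_tangent hD hpr htr
  have hcdf := cdf_eq_one_of_notMem_typeRange ht htr
  have hpt : p ≤ t :=
    le_of_not_ge fun h => (hpr.2.trans_le (hcdf ▸ monotone_cdf D h)).false
  have hzero : revenueCurve D t = 0 := by rw [revenueCurve, hcdf, sub_self, mul_zero]
  rw [hzero]
  exact add_nonneg (revenueCurve_nonneg D hp) (mul_nonneg hslope (sub_nonneg.2 hpt))

theorem IsValueDistribution.exists_isSupportingSlope (hD : IsValueDistribution D f)
    (hreg : IsRegular D f ∨ IsDMR D f) (hp : 0 ≤ p) (hpv : p ≤ v)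
    (hlt : revenueCurve D p < revenueCurve D v) : ∃ l, IsSupportingSlope D p l :=
  hreg.elim (fun h => h.exists_isSupportingSlope hD hp hpv hlt)
    fun h => h.exists_isSupportingSlope hD hp hpv hlt

/-! ### Effective values -/

theorem IsValueDistribution.measure_setOf_le_eq_zero_or_exists (hD : IsValueDistribution D f)
    {s : ℝ → ℝ≥0∞} (hs : Continuous s) (b : ℝ≥0∞) :
    D {v | b ≤ s v} = 0 ∨
      ∃ t, 0 ≤ t ∧ b ≤ s t ∧ D {v | b ≤ s v} ≤ ENNReal.ofReal (1 - cdf D t) := by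
  set S : Set ℝ := Ici 0 ∩ {v | b ≤ s v}
  have hS : D {v | b ≤ s v} = D S := measure_congr <| by
    filter_upwards [hD.ae_nonneg] with v hv
    exact propext ⟨fun h => ⟨hv, h⟩, fun h => h.2⟩
  rcases S.eq_empty_or_nonempty with hempty | hne
  · exact .inl (by rw [hS, hempty, measure_empty])
  have hbdd : BddBelow S := ⟨0, fun v hv => hv.1⟩
  have hclosed : IsClosed S := isClosed_Ici.inter (isClosed_le continuous_const hs)
  obtain ⟨hnonneg, hle⟩ := hclosed.csInf_mem hne hbdd
  refine .inr ⟨sInf S, hnonneg, hle, ?_⟩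
  rw [hS, ← hD.measure_Ici]
  exact measure_mono fun v hv => csInf_le hbdd hv

/-- The utility of a buyer with value `v` who faces only the single-lottery mechanism. -/
noncomputable def lotterySurplus (z p v : ℝ) : ℝ := z * max (v - p) 0

theorem lotterySurplus_of_le (hv : v ≤ p) : lotterySurplus z p v = 0 := by
  rw [lotterySurplus, max_eq_right (sub_nonpos.2 hv), mul_zero]

theorem lotterySurplus_of_ge (hv : p ≤ v) : lotterySurplus z p v = z * (v - p) := by
  rw [lotterySurplus, max_eq_left (sub_nonneg.2 hv)]

/-- What receiving Bob's good for sure adds to the utility of a buyer with value `v` who otherwise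
buys Alice's lottery. -/
noncomputable def effectiveValue (z p v : ℝ) : ℝ := v - lotterySurplus z p v

theorem continuous_effectiveValue (z p : ℝ) : Continuous (effectiveValue z p) := by
  unfold effectiveValue lotterySurplus
  fun_prop

theorem effectiveValue_of_le (hv : v ≤ p) : effectiveValue z p v = v := by
  rw [effectiveValue, lotterySurplus_of_le hv, sub_zero]

theorem effectiveValue_of_ge (hv : p ≤ v) : effectiveValue z p v = z * p + (1 - z) * v := by
  rw [effectiveValue, lotterySurplus_of_ge hv]
  ring

theorem effectiveValue_le (hz : 0 ≤ z) (p v : ℝ) : effectiveValue z p v ≤ v :=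
  sub_le_self v (mul_nonneg hz (le_max_right _ _))

theorem le_effectiveValue {q : ℝ} (hz : z ∈ Icc (0 : ℝ) 1) (hqp : q ≤ p) (hqv : q ≤ v) :
    q ≤ effectiveValue z p v := by
  rcases le_total v p with hvp | hpv
  · rwa [effectiveValue_of_le hvp]
  · rw [effectiveValue_of_ge hpv]
    nlinarith [mul_le_mul_of_nonneg_left hqp hz.1,
      mul_le_mul_of_nonneg_left hqv (sub_nonneg.2 hz.2)]

/-- The probability that the effective value is at least `b`. -/
noncomputable def effectiveDemand (D : Measure ℝ) (z p : ℝ) (b : ℝ≥0∞) : ℝ≥0∞ :=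
  D {v | b ≤ ENNReal.ofReal (effectiveValue z p v)}

theorem IsValueDistribution.effectiveDemand_eq_zero_or_exists (hD : IsValueDistribution D f)
    (z p : ℝ) (b : ℝ≥0∞) :
    effectiveDemand D z p b = 0 ∨ ∃ t, 0 ≤ t ∧ b ≤ ENNReal.ofReal (effectiveValue z p t) ∧
      effectiveDemand D z p b ≤ ENNReal.ofReal (1 - cdf D t) :=
  hD.measure_setOf_le_eq_zero_or_exists
    (ENNReal.continuous_ofReal.comp (continuous_effectiveValue z p)) b

theorem IsMyersonPrice.mul_effectiveDemand_le (hv : IsMyersonPrice D v)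
    (hD : IsValueDistribution D f) (hz : 0 ≤ z) (p : ℝ) (b : ℝ≥0∞) :
    b * effectiveDemand D z p b ≤ ENNReal.ofReal (revenueCurve D v) := by
  rcases hD.effectiveDemand_eq_zero_or_exists z p b with h | ⟨t, ht, hb, hdem⟩
  · simp [h]
  calc b * effectiveDemand D z p b ≤ ENNReal.ofReal t * ENNReal.ofReal (1 - cdf D t) :=
        mul_le_mul' (hb.trans (ENNReal.ofReal_le_ofReal (effectiveValue_le hz p t))) hdem
    _ = ENNReal.ofReal (revenueCurve D t) := (ENNReal.ofReal_mul ht).symm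
    _ ≤ ENNReal.ofReal (revenueCurve D v) := ENNReal.ofReal_le_ofReal (hv.2 ht)

theorem IsSupportingSlope.effectiveValue_mul_le {l : ℝ} (hl : IsSupportingSlope D p l)
    (hz : z ∈ Icc (0 : ℝ) 1) (hp : 0 ≤ p) (ht : 0 ≤ t) :
    effectiveValue z p t * (1 - cdf D t) ≤ revenueCurve D p + l * (effectiveValue z p t - p) := by
  rcases le_total t p with htp | hpt
  · rw [effectiveValue_of_le htp]
    exact hl.le t ht
  · have hcdf : p * (1 - cdf D t) ≤ revenueCurve D p :=
      mul_le_mul_of_nonneg_left (sub_le_sub_left (monotone_cdf D hpt) 1) hp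
    have hcurve := hl.le t ht
    simp only [revenueCurve] at hcurve hcdf ⊢
    rw [effectiveValue_of_ge hpt]
    nlinarith [mul_le_mul_of_nonneg_left hcdf hz.1,
      mul_le_mul_of_nonneg_left hcurve (sub_nonneg.2 hz.2)]

theorem IsSupportingSlope.mul_effectiveDemand_le {l : ℝ} (hl : IsSupportingSlope D p l)
    (hD : IsValueDistribution D f) (hz : z ∈ Icc (0 : ℝ) 1) (hp : 0 ≤ p) (b : ℝ≥0∞) :
    b * effectiveDemand D z p b ≤
      ENNReal.ofReal (revenueCurve D p - l * p) + ENNReal.ofReal l * b := by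
  rcases hD.effectiveDemand_eq_zero_or_exists z p b with h | ⟨t, ht, hb, hdem⟩
  · simp [h]
  set s := effectiveValue z p t
  lift b to NNReal using ne_top_of_le_ne_top ENNReal.ofReal_ne_top hb
  have hintercept : 0 ≤ revenueCurve D p - l * p := by
    simpa [revenueCurve] using hl.le 0 le_rfl
  have hline : (b : ℝ) * (1 - cdf D t) ≤ revenueCurve D p - l * p + l * b := by
    rcases le_total s 0 with hs | hs
    · have : (b : ℝ) = 0 := by
        rw [ENNReal.ofReal_eq_zero.2 hs] at hb
        simpa using hb
      simpa [this] using hintercept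
    have hbs : (b : ℝ) ≤ s := by
      rwa [← ENNReal.ofReal_coe_nnreal, ENNReal.ofReal_le_ofReal_iff hs] at hb
    rcases le_total (1 - cdf D t) l with hlG | hlG
    · nlinarith [mul_le_mul_of_nonneg_left hlG b.coe_nonneg]
    · nlinarith [hl.effectiveValue_mul_le hz hp ht,
        mul_le_mul_of_nonneg_right hbs (sub_nonneg.2 hlG)]
  calc (b : ℝ≥0∞) * effectiveDemand D z p b
      ≤ ENNReal.ofReal b * ENNReal.ofReal (1 - cdf D t) := by
        rw [ENNReal.ofReal_coe_nnreal]
        gcongr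
    _ = ENNReal.ofReal (b * (1 - cdf D t)) := (ENNReal.ofReal_mul b.coe_nonneg).symm
    _ ≤ ENNReal.ofReal (revenueCurve D p - l * p + l * b) := ENNReal.ofReal_le_ofReal hline
    _ = ENNReal.ofReal (revenueCurve D p - l * p) + ENNReal.ofReal l * b := by
        rw [ENNReal.ofReal_add hintercept (mul_nonneg hl.nonneg b.coe_nonneg),
          ENNReal.ofReal_mul hl.nonneg, ENNReal.ofReal_coe_nnreal]

theorem IsMyersonPrice.sub_mul_effectiveDemand_le (hv : IsMyersonPrice D v)
    (hD : IsValueDistribution D f) (hz : z ∈ Icc (0 : ℝ) 1) (hp : 0 ≤ p)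
    {b : ℝ≥0∞} (hb : ENNReal.ofReal p ≤ b) :
    (b - ENNReal.ofReal (z * p)) * effectiveDemand D z p b ≤
      ENNReal.ofReal ((1 - z) * revenueCurve D v) := by
  rcases hD.effectiveDemand_eq_zero_or_exists z p b with h | ⟨t, ht, hbt, hdem⟩
  · simp [h]
  have hpt : p ≤ t := (ENNReal.ofReal_le_ofReal_iff ht).1 <|
    (hb.trans hbt).trans (ENNReal.ofReal_le_ofReal (effectiveValue_le hz.1 p t))
  have hz1 : 0 ≤ 1 - z := sub_nonneg.2 hz.2
  calc (b - ENNReal.ofReal (z * p)) * effectiveDemand D z p b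
      ≤ ENNReal.ofReal ((1 - z) * t) * ENNReal.ofReal (1 - cdf D t) := by
        refine mul_le_mul' (tsub_le_iff_right.2 ?_) hdem
        rwa [← ENNReal.ofReal_add (mul_nonneg hz1 ht) (mul_nonneg hz.1 hp), add_comm,
          ← effectiveValue_of_ge hpt]
    _ = ENNReal.ofReal ((1 - z) * revenueCurve D t) := by
        rw [← ENNReal.ofReal_mul (mul_nonneg hz1 ht), mul_assoc, revenueCurve]
    _ ≤ ENNReal.ofReal ((1 - z) * revenueCurve D v) := by
        gcongr
        exact hv.2 ht

/-! ### Direct mechanisms -/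

section DirectMechanism

variable {α : Type*} {s x c c' : α → ℝ} {v w : α} {y : ℝ}

/-- A direct mechanism that sells one good to a buyer who values it at `s v` if his type is `v`:
reporting `v` means receiving the good with probability `x v` and paying `c v` in expectation.
Truth-telling is optimal and no worse than not participating. -/
structure IsDirectMechanism (s x c : α → ℝ) : Prop where
  alloc_mem : ∀ v, x v ∈ Icc (0 : ℝ) 1
  pay_nonneg : ∀ v, 0 ≤ c v
  rational : ∀ v, c v ≤ s v * x v
  truthful : ∀ v w, s v * x w - c w ≤ s v * x v - c v

/-- The lowest value of a type that receives the good with probability at least `y`. -/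
noncomputable def thresholdPrice (s x : α → ℝ) (y : ℝ) : ℝ≥0∞ :=
  ⨅ v, ⨅ _ : y ≤ x v, ENNReal.ofReal (s v)

theorem thresholdPrice_le (hy : y ≤ x v) : thresholdPrice s x y ≤ ENNReal.ofReal (s v) :=
  iInf₂_le v hy

theorem monotone_thresholdPrice (s x : α → ℝ) : Monotone (thresholdPrice s x) :=
  fun _ _ hyy' => le_iInf₂ fun _ hv => thresholdPrice_le (hyy'.trans hv)

namespace IsDirectMechanism

theorem alloc_eq_zero (h : IsDirectMechanism s x c) (hv : s v < 0) : x v = 0 :=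
  le_antisymm (nonpos_of_mul_nonneg_right ((h.pay_nonneg v).trans (h.rational v)) hv)
    (h.alloc_mem v).1

theorem pay_eq_zero (h : IsDirectMechanism s x c) (hv : s v ≤ 0) : c v = 0 :=
  le_antisymm ((h.rational v).trans (mul_nonpos_of_nonpos_of_nonneg hv (h.alloc_mem v).1))
    (h.pay_nonneg v)

theorem le_of_alloc_lt (h : IsDirectMechanism s x c) (hvw : x v < x w) : s v ≤ s w := by
  nlinarith [h.truthful v w, h.truthful w v]

theorem abs_pay_sub_pay_sub_le (h : IsDirectMechanism s x c) (h' : IsDirectMechanism s x c')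
    (v w : α) :
    |(c w - c' w) - (c v - c' v)| ≤ (s w - s v) * (x w - x v) := by
  rw [abs_le]
  constructor <;>
    linarith [h.truthful v w, h.truthful w v, h'.truthful v w, h'.truthful w v]

/-- Subdividing the values below `s w` into steps of length `d`, the payments of two mechanisms
with the same allocation drift apart by at most `d` times the increase of the allocation in each
step. -/
theorem abs_pay_sub_pay_le [TopologicalSpace α] [PreconnectedSpace α] (hs : Continuous s) {o : α}
    (ho : s o ≤ 0) (h : IsDirectMechanism s x c) (h' : IsDirectMechanism s x c') {d : ℝ}
    (hd : 0 ≤ d) (k : ℕ) : ∀ w, s w = k * d → |c w - c' w| ≤ d * x w := by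
  induction k with
  | zero =>
    intro w hw
    have hw0 : s w ≤ 0 := by rw [hw, Nat.cast_zero, zero_mul]
    rw [h.pay_eq_zero hw0, h'.pay_eq_zero hw0, sub_zero, abs_zero]
    exact mul_nonneg hd (h.alloc_mem w).1
  | succ k ih =>
    intro w hw
    push_cast at hw
    have hkd : (0 : ℝ) ≤ k * d := by positivity
    obtain ⟨v, hv⟩ : k * d ∈ range s := mem_range_of_exists_le_of_exists_ge hs
      ⟨o, ho.trans hkd⟩ ⟨w, by linarith⟩
    have hstep := h.abs_pay_sub_pay_sub_le h' v w
    have hsv : s w - s v = d := by linarith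
    rw [hsv] at hstep
    linarith [ih v hv, abs_sub_abs_le_abs_sub (c w - c' w) (c v - c' v)]

theorem pay_eq_pay [TopologicalSpace α] [PreconnectedSpace α] (hs : Continuous s) {o : α}
    (ho : s o ≤ 0) (h : IsDirectMechanism s x c) (h' : IsDirectMechanism s x c') (w : α) :
    c w = c' w := by
  rcases le_total (s w) 0 with hw | hw
  · rw [h.pay_eq_zero hw, h'.pay_eq_zero hw]
  have hbound : ∀ n : ℕ, |c w - c' w| ≤ s w / (n + 1) := fun n => by
    refine (h.abs_pay_sub_pay_le hs ho h' (d := s w / (n + 1)) (by positivity) (n + 1) w ?_).trans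
      (mul_le_of_le_one_right (by positivity) (h.alloc_mem w).2)
    push_cast
    field_simp
  by_contra hne
  obtain ⟨n, hn⟩ := exists_nat_gt (s w / |c w - c' w|)
  have hpos : 0 < |c w - c' w| := abs_pos.2 (sub_ne_zero.2 hne)
  have hle := hbound n
  rw [le_div_iff₀ (by positivity)] at hle
  rw [div_lt_iff₀ hpos] at hn
  linarith

theorem le_thresholdPrice (h : IsDirectMechanism s x c) (hy : x v < y) :
    ENNReal.ofReal (s v) ≤ thresholdPrice s x y :=
  le_iInf₂ fun _ hw => ENNReal.ofReal_le_ofReal (h.le_of_alloc_lt (hy.trans_le hw))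

end IsDirectMechanism

theorem lintegral_thresholdPrice_le (s x : α → ℝ) (v : α) (a : ℝ) :
    ∫⁻ y in Ioc a (x v), thresholdPrice s x y ≤ ENNReal.ofReal (s v) * ENNReal.ofReal (x v - a) :=
  calc ∫⁻ y in Ioc a (x v), thresholdPrice s x y
      ≤ ∫⁻ _ in Ioc a (x v), ENNReal.ofReal (s v) :=
        setLIntegral_mono' measurableSet_Ioc fun _ hy => thresholdPrice_le hy.2
    _ = ENNReal.ofReal (s v) * ENNReal.ofReal (x v - a) := by
        rw [setLIntegral_const, Real.volume_Ioc]

theorem lintegral_thresholdPrice_ne_top (s x : α → ℝ) (v : α) (a : ℝ) :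
    ∫⁻ y in Ioc a (x v), thresholdPrice s x y ≠ ∞ :=
  ne_top_of_le_ne_top (ENNReal.mul_ne_top ENNReal.ofReal_ne_top ENNReal.ofReal_ne_top)
    (lintegral_thresholdPrice_le s x v a)

theorem IsDirectMechanism.le_lintegral_thresholdPrice (h : IsDirectMechanism s x c) (v : α)
    (a : ℝ) :
    ENNReal.ofReal (s v) * ENNReal.ofReal (a - x v) ≤ ∫⁻ y in Ioc (x v) a, thresholdPrice s x y :=
  calc ENNReal.ofReal (s v) * ENNReal.ofReal (a - x v)
      = ∫⁻ _ in Ioc (x v) a, ENNReal.ofReal (s v) := by rw [setLIntegral_const, Real.volume_Ioc]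
    _ ≤ ∫⁻ y in Ioc (x v) a, thresholdPrice s x y :=
        setLIntegral_mono' measurableSet_Ioc fun _ hy => h.le_thresholdPrice hy.1

/-- The payment of a type that buys every infinitesimal unit of probability that it receives at
the threshold price of that unit. -/
noncomputable def thresholdPayment (s x : α → ℝ) (v : α) : ℝ :=
  (∫⁻ y in Ioc 0 (x v), thresholdPrice s x y).toReal

theorem thresholdPayment_add (hv : 0 ≤ x v) (hvw : x v ≤ x w) :
    thresholdPayment s x w =
      thresholdPayment s x v + (∫⁻ y in Ioc (x v) (x w), thresholdPrice s x y).toReal := by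
  rw [thresholdPayment, thresholdPayment, ← Ioc_union_Ioc_eq_Ioc hv hvw,
    lintegral_union measurableSet_Ioc (Ioc_disjoint_Ioc_of_le le_rfl),
    ENNReal.toReal_add (lintegral_thresholdPrice_ne_top s x v 0)
      (lintegral_thresholdPrice_ne_top s x w (x v))]

namespace IsDirectMechanism

theorem thresholdPayment_rational (h : IsDirectMechanism s x c) (v : α) :
    thresholdPayment s x v ≤ s v * x v := by
  rcases lt_or_ge (s v) 0 with hv | hv
  · simp [thresholdPayment, h.alloc_eq_zero hv]
  have hle := lintegral_thresholdPrice_le s x v 0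
  rw [sub_zero, ← ENNReal.ofReal_mul hv] at hle
  exact ENNReal.toReal_le_of_le_ofReal (mul_nonneg hv (h.alloc_mem v).1) hle

theorem thresholdPayment_truthful (h : IsDirectMechanism s x c) (v w : α) :
    s v * x w - thresholdPayment s x w ≤ s v * x v - thresholdPayment s x v := by
  rcases le_total (x v) (x w) with hvw | hwv
  · have hle := ENNReal.toReal_mono (lintegral_thresholdPrice_ne_top s x w (x v))
      (h.le_lintegral_thresholdPrice v (x w))
    rw [ENNReal.toReal_mul, ENNReal.toReal_ofReal (sub_nonneg.2 hvw),
      ENNReal.toReal_ofReal'] at hle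
    rw [thresholdPayment_add (h.alloc_mem v).1 hvw]
    linarith [mul_le_mul_of_nonneg_right (le_max_left (s v) 0) (sub_nonneg.2 hvw)]
  · rcases lt_or_ge (s v) 0 with hv | hv
    · have hw : x w = x v := by linarith [h.alloc_eq_zero hv, (h.alloc_mem w).1]
      rw [thresholdPayment, thresholdPayment, hw]
    have hle := lintegral_thresholdPrice_le s x v (x w)
    rw [← ENNReal.ofReal_mul hv] at hle
    rw [thresholdPayment_add (h.alloc_mem w).1 hwv]
    linarith [ENNReal.toReal_le_of_le_ofReal (mul_nonneg hv (sub_nonneg.2 hwv)) hle]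

theorem isDirectMechanism_thresholdPayment (h : IsDirectMechanism s x c) :
    IsDirectMechanism s x (thresholdPayment s x) where
  alloc_mem := h.alloc_mem
  pay_nonneg _ := ENNReal.toReal_nonneg
  rational := h.thresholdPayment_rational
  truthful := h.thresholdPayment_truthful

theorem lintegral_thresholdPrice_eq [TopologicalSpace α] [PreconnectedSpace α] (hs : Continuous s)
    {o : α} (ho : s o ≤ 0) (h : IsDirectMechanism s x c) (v : α) :
    ∫⁻ y in Ioc 0 (x v), thresholdPrice s x y = ENNReal.ofReal (c v) := by
  rw [h.pay_eq_pay hs ho h.isDirectMechanism_thresholdPayment v, thresholdPayment,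
    ENNReal.ofReal_toReal (lintegral_thresholdPrice_ne_top s x v 0)]

end IsDirectMechanism

theorem lintegral_le_lintegral_mul_demand [MeasurableSpace α] (μ : Measure α) [SFinite μ]
    (hs : Measurable s) (hx : ∀ v, x v ≤ 1) {k : ℝ → ℝ≥0∞} (hk : Measurable k) {r : α → ℝ≥0∞}
    (hr : ∀ v, r v ≤ ∫⁻ y in Ioc 0 (x v), k y) :
    ∫⁻ v, r v ∂μ ≤
      ∫⁻ y in Ioc 0 1, k y * μ {v | thresholdPrice s x y ≤ ENNReal.ofReal (s v)} := by
  have hmeas : MeasurableSet {q : α × ℝ | thresholdPrice s x q.2 ≤ ENNReal.ofReal (s q.1)} :=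
    measurableSet_le ((monotone_thresholdPrice s x).measurable.comp measurable_snd)
      (ENNReal.measurable_ofReal.comp (hs.comp measurable_fst))
  set S : Set (α × ℝ) := {q | thresholdPrice s x q.2 ≤ ENNReal.ofReal (s q.1)}
  have hsold : ∀ v, ∫⁻ y in Ioc 0 (x v), k y ≤
      ∫⁻ y in Ioc 0 1, S.indicator (fun q => k q.2) (v, y) := fun v =>
    calc ∫⁻ y in Ioc 0 (x v), k y
        ≤ ∫⁻ y in Ioc 0 (x v), S.indicator (fun q => k q.2) (v, y) :=
          setLIntegral_mono' measurableSet_Ioc fun y hy => by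
            rw [indicator_of_mem (show (v, y) ∈ S from thresholdPrice_le hy.2)]
      _ ≤ ∫⁻ y in Ioc 0 1, S.indicator (fun q => k q.2) (v, y) :=
          lintegral_mono_set (Ioc_subset_Ioc_right (hx v))
  calc ∫⁻ v, r v ∂μ ≤ ∫⁻ v, (∫⁻ y in Ioc 0 1, S.indicator (fun q => k q.2) (v, y)) ∂μ :=
        lintegral_mono fun v => (hr v).trans (hsold v)
    _ = ∫⁻ y in Ioc 0 1, (∫⁻ v, S.indicator (fun q => k q.2) (v, y) ∂μ) :=
        lintegral_lintegral_swap ((hk.comp measurable_snd).indicator hmeas).aemeasurable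
    _ = ∫⁻ y in Ioc 0 1, k y * μ {v | thresholdPrice s x y ≤ ENNReal.ofReal (s v)} := by
        refine lintegral_congr fun y => ?_
        exact lintegral_indicator_const (hmeas.preimage measurable_prodMk_right) (k y)

end DirectMechanism

theorem setLIntegral_Ioc_le_of_forall_lt {g : ℝ → ℝ≥0∞} {a b : ℝ} {C : ℝ≥0∞}
    (h : ∀ b' < b, ∫⁻ y in Ioc a b', g y ≤ C) : ∫⁻ y in Ioc a b, g y ≤ C := by
  obtain ⟨u, hmono, hlt, hlim⟩ := exists_seq_strictMono_tendsto b
  have hunion : Ioo a b = ⋃ n, Ioc a (u n) := by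
    simp only [← Ioi_inter_Iic, ← inter_iUnion,
      iUnion_Iic_eq_Iio_of_lt_of_tendsto hlt hlim, Ioi_inter_Iio]
  have hdir : Directed (· ⊆ ·) fun n => Ioc a (u n) :=
    (monotone_nat_of_le_succ fun n =>
      Ioc_subset_Ioc_right (hmono.monotone n.le_succ)).directed_le
  rw [← setLIntegral_congr Ioo_ae_eq_Ioc, hunion, setLIntegral_iUnion_of_directed g hdir]
  exact iSup_le fun n => h (u n) (hlt n)

/-! ### Choices of the buyer -/

section Choice

variable {A B : Pricing} {σ τ : Strategy} {a x : ℝ}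

/-- The objective of the buyer, lexicographically ordered: expected utility, then the expected
allocation from Bob, then the expected allocation from Alice. -/
noncomputable def objective (A B : Pricing) (v : ℝ) (σ : Strategy) : ℝ ×ₗ ℝ ×ₗ ℝ :=
  toLex (utility A B v σ, toLex (allocB σ, allocA σ))

theorem isChoice_iff_objective_le :
    IsChoice A B v σ ↔
      Feasible A B σ ∧ ∀ τ, Feasible A B τ → objective A B v τ ≤ objective A B v σ := by
  simp only [IsChoice, objective, Prod.Lex.toLex_le_toLex]

theorem objective_le_of_utility_lt (h : utility A B v σ < utility A B v τ) :
    objective A B v σ ≤ objective A B v τ :=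
  Prod.Lex.toLex_le_toLex.2 (.inl h)

theorem IsChoice.utility_le (h : IsChoice A B v σ) (hτ : Feasible A B τ) :
    utility A B v τ ≤ utility A B v σ :=
  (h.2 τ hτ).elim le_of_lt fun h => h.1.le

theorem IsChoice.allocB_le (h : IsChoice A B v σ) (hτ : Feasible A B τ)
    (hle : utility A B v σ ≤ utility A B v τ) : allocB τ ≤ allocB σ :=
  (h.2 τ hτ).elim (fun hlt => absurd hlt hle.not_gt)
    fun heq => heq.2.elim le_of_lt fun heq => heq.1.le

theorem IsChoice.allocA_le (h : IsChoice A B v σ) (hτ : Feasible A B τ)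
    (hle : utility A B v σ ≤ utility A B v τ) (hB : allocB σ ≤ allocB τ) :
    allocA τ ≤ allocA σ :=
  (h.2 τ hτ).elim (fun hlt => absurd hlt hle.not_gt)
    fun heq => heq.2.elim (fun hlt => absurd hlt hB.not_gt) fun heq => heq.2

theorem isChoice_choice (h : ∃ σ, IsChoice A B v σ) : IsChoice A B v (choice A B v) := by
  rw [choice, dif_pos h]
  exact h.choose_spec

theorem exists_isMaxOn_toLex {X β γ : Type*} [TopologicalSpace X] [T2Space X] [LinearOrder β]
    [TopologicalSpace β] [OrderClosedTopology β] [Preorder γ] {K : Set X} (hK : IsCompact K)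
    (hne : K.Nonempty) {g : X → β} (hg : ContinuousOn g K) {h : X → γ}
    (hh : ∀ L ⊆ K, IsCompact L → L.Nonempty → ∃ x ∈ L, IsMaxOn h L x) :
    ∃ x ∈ K, IsMaxOn (fun x => toLex (g x, h x)) K x := by
  obtain ⟨x₀, hx₀, hmax⟩ := hK.exists_isMaxOn hne hg
  have hclosed : IsClosed (K ∩ g ⁻¹' Ici (g x₀)) :=
    hg.preimage_isClosed_of_isClosed hK.isClosed isClosed_Ici
  obtain ⟨x, hx, hxmax⟩ := hh _ inter_subset_left
    (hK.of_isClosed_subset hclosed inter_subset_left) ⟨x₀, hx₀, le_rfl⟩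
  refine ⟨x, hx.1, fun y hy => Prod.Lex.toLex_le_toLex.2 ?_⟩
  rcases ((hmax hy).trans hx.2).lt_or_eq with hlt | heq
  · exact .inl hlt
  · exact .inr ⟨heq, hxmax ⟨hy, hx.2.trans heq.ge⟩⟩

theorem singleLottery_of_le (ha : a ≤ z) : singleLottery z p a = ENNReal.ofReal (p * a) :=
  if_pos ha

theorem feasible_singleLottery_iff (hz : z ≤ 1) :
    Feasible (singleLottery z p) B σ ↔
      σ.xA ∈ Icc 0 z ∧ σ.xB ∈ Icc (0 : ℝ) 1 ∧ B σ.xB ≠ ∞ := by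
  by_cases h : σ.xA ≤ z
  · simp [Feasible, singleLottery, h, h.trans hz]
  · simp [Feasible, singleLottery, h]

theorem utility_alice (hp : 0 ≤ p) (ha : a ∈ Icc 0 z) (B : Pricing) (v x : ℝ) :
    utility (singleLottery z p) B v ⟨.alice, a, x⟩ =
      a * (v - p) + (1 - a) * (x * v - (B x).toReal) := by
  simp only [utility, singleLottery_of_le ha.2, ENNReal.toReal_ofReal (mul_nonneg hp ha.1)]
  ring

theorem utility_bob (hp : 0 ≤ p) (ha : a ∈ Icc 0 z) (B : Pricing) (v x : ℝ) :
    utility (singleLottery z p) B v ⟨.bob, a, x⟩ =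
      (x * v - (B x).toReal) + (1 - x) * (a * (v - p)) := by
  simp only [utility, singleLottery_of_le ha.2, ENNReal.toReal_ofReal (mul_nonneg hp ha.1)]
  ring

/-! ### Existence of choices -/

/-- The probabilities that Bob offers at a price of at most `v`. -/
def affordable (B : Pricing) (v : ℝ) : Set ℝ := {x ∈ Icc (0 : ℝ) 1 | B x ≤ ENNReal.ofReal v}

theorem zero_mem_affordable (h0 : B 0 = 0) (v : ℝ) : 0 ∈ affordable B v :=
  ⟨left_mem_Icc.2 zero_le_one, h0 ▸ zero_le⟩

theorem affordable_subset (B : Pricing) (v : ℝ) : affordable B v ⊆ Icc 0 (maxProb B) := fun _ hx =>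
  ⟨hx.1.1, le_csSup ⟨1, fun _ hy => hy.1.2⟩ ⟨hx.1, hx.2.trans_lt ENNReal.ofReal_lt_top⟩⟩

theorem isCompact_affordable (hB : ContinuousOn B (Icc 0 (maxProb B))) (v : ℝ) :
    IsCompact (affordable B v) := by
  have heq : affordable B v =
      Icc 0 1 ∩ (Icc 0 (maxProb B) ∩ B ⁻¹' Iic (ENNReal.ofReal v)) :=
    Subset.antisymm (fun x hx => ⟨hx.1, affordable_subset B v hx, hx.2⟩)
      fun x hx => ⟨hx.1, hx.2.2⟩
  rw [heq]
  exact isCompact_Icc.inter_right (hB.preimage_isClosed_of_isClosed isClosed_Icc isClosed_Iic)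

theorem mul_lt_toReal_of_notMem_affordable (hx : x ∈ Icc (0 : ℝ) 1) (hBx : B x ≠ ∞)
    (h : x ∉ affordable B v) : x * v < (B x).toReal := by
  have hlt : ENNReal.ofReal v < B x := not_le.1 fun hle => h ⟨hx, hle⟩
  calc x * v ≤ x * max v 0 := mul_le_mul_of_nonneg_left (le_max_left v 0) hx.1
    _ ≤ max v 0 := mul_le_of_le_one_left (le_max_right v 0) hx.2
    _ = (ENNReal.ofReal v).toReal := ENNReal.toReal_ofReal'.symm
    _ < (B x).toReal := ENNReal.toReal_strict_mono hBx hlt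

theorem continuousOn_utility_singleLottery (hp : 0 ≤ p) (hB : ContinuousOn B (Icc 0 (maxProb B)))
    (v : ℝ) (o : Seller) :
    ContinuousOn (fun q : ℝ × ℝ => utility (singleLottery z p) B v ⟨o, q.1, q.2⟩)
      (Icc 0 z ×ˢ affordable B v) := by
  have hprice : ContinuousOn (fun q : ℝ × ℝ => (B q.2).toReal) (Icc 0 z ×ˢ affordable B v) :=
    ENNReal.continuousOn_toReal.comp
      (hB.comp continuousOn_snd fun q hq => affordable_subset B v hq.2)
      fun q hq => ne_top_of_le_ne_top ENNReal.ofReal_ne_top hq.2.2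
  have hsurplus : ContinuousOn (fun q : ℝ × ℝ => q.2 * v - (B q.2).toReal)
      (Icc 0 z ×ˢ affordable B v) := (continuousOn_snd.mul continuousOn_const).sub hprice
  cases o
  · refine ContinuousOn.congr ?_ fun q hq => utility_alice hp hq.1 B v q.2
    exact (by fun_prop : Continuous fun q : ℝ × ℝ => q.1 * (v - p)).continuousOn.add
      ((by fun_prop : Continuous fun q : ℝ × ℝ => 1 - q.1).continuousOn.mul hsurplus)
  · refine ContinuousOn.congr ?_ fun q hq => utility_bob hp hq.1 B v q.2
    exact hsurplus.add
      (by fun_prop : Continuous fun q : ℝ × ℝ => (1 - q.2) * (q.1 * (v - p))).continuousOn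

theorem continuous_allocA (o : Seller) : Continuous fun q : ℝ × ℝ => allocA ⟨o, q.1, q.2⟩ := by
  cases o <;> simp only [allocA] <;> fun_prop

theorem continuous_allocB (o : Seller) : Continuous fun q : ℝ × ℝ => allocB ⟨o, q.1, q.2⟩ := by
  cases o <;> simp only [allocB] <;> fun_prop

theorem exists_objective_ge_of_affordable (hz : 0 ≤ z) (hp : 0 ≤ p) (h0 : B 0 = 0)
    (hB : ContinuousOn B (Icc 0 (maxProb B))) (v : ℝ) :
    ∃ σ : Strategy, (σ.xA ∈ Icc 0 z ∧ σ.xB ∈ affordable B v) ∧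
      ∀ τ : Strategy, τ.xA ∈ Icc 0 z ∧ τ.xB ∈ affordable B v →
        objective (singleLottery z p) B v τ ≤ objective (singleLottery z p) B v σ := by
  have hmax : ∀ o : Seller, ∃ q ∈ Icc 0 z ×ˢ affordable B v,
      IsMaxOn (fun q : ℝ × ℝ => objective (singleLottery z p) B v ⟨o, q.1, q.2⟩)
        (Icc 0 z ×ˢ affordable B v) q := fun o =>
    exists_isMaxOn_toLex (isCompact_Icc.prod (isCompact_affordable hB v))
      ⟨(0, 0), left_mem_Icc.2 hz, zero_mem_affordable h0 v⟩
      (continuousOn_utility_singleLottery hp hB v o)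
      fun _ _ hL hne => exists_isMaxOn_toLex hL hne (continuous_allocB o).continuousOn
        fun _ _ hL' hne' => hL'.exists_isMaxOn hne' (continuous_allocA o).continuousOn
  obtain ⟨qA, hqA, hA⟩ := hmax .alice
  obtain ⟨qB, hqB, hB⟩ := hmax .bob
  rcases le_total (objective (singleLottery z p) B v ⟨.alice, qA.1, qA.2⟩)
    (objective (singleLottery z p) B v ⟨.bob, qB.1, qB.2⟩) with hAB | hBA
  · refine ⟨⟨.bob, qB.1, qB.2⟩, hqB, ?_⟩
    rintro ⟨_ | _, a, x⟩ hτ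
    exacts [(hA (a := (a, x)) hτ).trans hAB, hB (a := (a, x)) hτ]
  · refine ⟨⟨.alice, qA.1, qA.2⟩, hqA, ?_⟩
    rintro ⟨_ | _, a, x⟩ hτ
    exacts [hA (a := (a, x)) hτ, (hB (a := (a, x)) hτ).trans hBA]

theorem exists_affordable_objective_ge (hz : z ∈ Icc (0 : ℝ) 1) (hp : 0 ≤ p) (h0 : B 0 = 0)
    (hτ : Feasible (singleLottery z p) B τ) (v : ℝ) :
    ∃ σ : Strategy, (σ.xA ∈ Icc 0 z ∧ σ.xB ∈ affordable B v) ∧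
      objective (singleLottery z p) B v τ ≤ objective (singleLottery z p) B v σ := by
  rw [feasible_singleLottery_iff hz.2] at hτ
  obtain ⟨o, a, x⟩ := τ
  obtain ⟨ha, hx, hBx⟩ := hτ
  by_cases hmem : x ∈ affordable B v
  · exact ⟨⟨o, a, x⟩, ⟨ha, hmem⟩, le_rfl⟩
  have hlt := mul_lt_toReal_of_notMem_affordable hx hBx hmem
  have h0z : 0 ∈ Icc 0 z := left_mem_Icc.2 hz.1
  have h0B := zero_mem_affordable h0 v
  cases o with
  | alice =>
    refine ⟨⟨.alice, a, 0⟩, ⟨ha, h0B⟩, ?_⟩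
    rcases (ha.2.trans hz.2).lt_or_eq with ha1 | rfl
    · apply objective_le_of_utility_lt
      rw [utility_alice hp ha, utility_alice hp ha, h0]
      simp only [ENNReal.toReal_zero, zero_mul, sub_zero, mul_zero, add_zero]
      nlinarith
    · simp [objective, utility_alice hp ha, allocA, allocB]
  | bob =>
    rcases le_total p v with hpv | hvp
    · refine ⟨⟨.bob, a, 0⟩, ⟨ha, h0B⟩, objective_le_of_utility_lt ?_⟩
      rw [utility_bob hp ha, utility_bob hp ha, h0, ENNReal.toReal_zero]
      nlinarith [mul_nonneg hx.1 (mul_nonneg ha.1 (sub_nonneg.2 hpv))]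
    · refine ⟨⟨.bob, 0, 0⟩, ⟨h0z, h0B⟩, objective_le_of_utility_lt ?_⟩
      rw [utility_bob hp ha, utility_bob hp h0z, h0, ENNReal.toReal_zero]
      nlinarith [mul_nonneg (sub_nonneg.2 hx.2) (mul_nonneg ha.1 (sub_nonneg.2 hvp))]

theorem exists_isChoice_singleLottery (hz : z ∈ Icc (0 : ℝ) 1) (hp : 0 ≤ p) (h0 : B 0 = 0)
    (hB : ContinuousOn B (Icc 0 (maxProb B))) (v : ℝ) :
    ∃ σ, IsChoice (singleLottery z p) B v σ := by
  obtain ⟨σ, hσ, hmax⟩ := exists_objective_ge_of_affordable hz.1 hp h0 hB v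
  have hfeas : Feasible (singleLottery z p) B σ := (feasible_singleLottery_iff hz.2).2
    ⟨hσ.1, hσ.2.1, ne_top_of_le_ne_top ENNReal.ofReal_ne_top hσ.2.2⟩
  refine ⟨σ, isChoice_iff_objective_le.2 ⟨hfeas, fun τ hτ => ?_⟩⟩
  obtain ⟨τ', hτ', hle⟩ := exists_affordable_objective_ge hz hp h0 hτ v
  exact hle.trans (hmax τ' hτ')

/-! ### The effective tariff -/

/-- Bob's mechanism costs nothing if nothing is bought, and against Alice's mechanism every type of
buyer has a choice. -/
structure IsAdmissible (A B : Pricing) : Prop where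
  map_zero : B 0 = 0
  exists_isChoice : ∀ v, ∃ σ, IsChoice A B v σ

theorem isAdmissible_of_continuousOn (hz : z ∈ Icc (0 : ℝ) 1) (hp : 0 ≤ p) (h0 : B 0 = 0)
    (hB : ContinuousOn B (Icc 0 (maxProb B))) : IsAdmissible (singleLottery z p) B :=
  ⟨h0, exists_isChoice_singleLottery hz hp h0 hB⟩

theorem isAdmissible_fixedPrice (hz : z ∈ Icc (0 : ℝ) 1) (hp : 0 ≤ p) (q : ℝ) :
    IsAdmissible (singleLottery z p) (fixedPrice q) :=
  isAdmissible_of_continuousOn hz hp (by simp [fixedPrice])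
    (ENNReal.continuous_ofReal.comp (continuous_const_mul q)).continuousOn

theorem IsAdmissible.isChoice_choice (h : IsAdmissible A B) (v : ℝ) :
    IsChoice A B v (choice A B v) :=
  Duopoly.isChoice_choice (h.exists_isChoice v)

theorem feasible_singleLottery_zero (hz : z ∈ Icc (0 : ℝ) 1) (h0 : B 0 = 0)
    (ha : a ∈ Icc 0 z) (o : Seller) : Feasible (singleLottery z p) B ⟨o, a, 0⟩ :=
  (feasible_singleLottery_iff hz.2).2 ⟨ha, left_mem_Icc.2 zero_le_one, by simp [h0]⟩

theorem IsChoice.utility_nonneg (hz : z ∈ Icc (0 : ℝ) 1) (hp : 0 ≤ p) (h0 : B 0 = 0)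
    (hσ : IsChoice (singleLottery z p) B v σ) : 0 ≤ utility (singleLottery z p) B v σ := by
  have h0z : 0 ∈ Icc 0 z := left_mem_Icc.2 hz.1
  have hle := hσ.utility_le (feasible_singleLottery_zero hz h0 h0z .bob)
  simpa [utility_bob hp h0z, h0] using hle

/-- The price of the probability `x` in terms of effective values: `B x` if Bob is approached
first, and `z * p * x + (1 - z) * B x` if Alice's lottery is bought first. -/
noncomputable def effectiveTariff (z p : ℝ) (B : Pricing) (x : ℝ) : ℝ :=
  min (B x).toReal (z * p * x + (1 - z) * (B x).toReal)

theorem effectiveTariff_zero (h0 : B 0 = 0) : effectiveTariff z p B 0 = 0 := by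
  simp [effectiveTariff, h0]

theorem effectiveTariff_nonneg (hz : z ∈ Icc (0 : ℝ) 1) (hp : 0 ≤ p) (hx : 0 ≤ x) :
    0 ≤ effectiveTariff z p B x :=
  le_min ENNReal.toReal_nonneg (add_nonneg (mul_nonneg (mul_nonneg hz.1 hp) hx)
    (mul_nonneg (sub_nonneg.2 hz.2) ENNReal.toReal_nonneg))

theorem effectiveTariff_of_le (hz : 0 ≤ z) (hx : (B x).toReal ≤ p * x) :
    effectiveTariff z p B x = (B x).toReal :=
  min_eq_left (by linarith [mul_le_mul_of_nonneg_left hx hz])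

theorem effectiveTariff_of_ge (hz : 0 ≤ z) (hx : p * x ≤ (B x).toReal) :
    effectiveTariff z p B x = z * p * x + (1 - z) * (B x).toReal :=
  min_eq_right (by linarith [mul_le_mul_of_nonneg_left hx hz])

theorem utility_bob_lottery (hp : 0 ≤ p) (hz : 0 ≤ z) (B : Pricing) (hpv : p ≤ v) (x : ℝ) :
    utility (singleLottery z p) B v ⟨.bob, z, x⟩ =
      lotterySurplus z p v + (effectiveValue z p v * x - (B x).toReal) := by
  rw [utility_bob hp (right_mem_Icc.2 hz), effectiveValue, lotterySurplus_of_ge hpv]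
  ring

theorem utility_alice_lottery (hp : 0 ≤ p) (hz : 0 ≤ z) (B : Pricing) (hpv : p ≤ v) (x : ℝ) :
    utility (singleLottery z p) B v ⟨.alice, z, x⟩ = lotterySurplus z p v +
      (effectiveValue z p v * x - (z * p * x + (1 - z) * (B x).toReal)) := by
  rw [utility_alice hp (right_mem_Icc.2 hz), effectiveValue, lotterySurplus_of_ge hpv]
  ring

theorem utility_bob_no_lottery (hp : 0 ≤ p) (hz : 0 ≤ z) (B : Pricing) (hvp : v ≤ p) (x : ℝ) :
    utility (singleLottery z p) B v ⟨.bob, 0, x⟩ =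
      lotterySurplus z p v + (effectiveValue z p v * x - (B x).toReal) := by
  rw [utility_bob hp (left_mem_Icc.2 hz), effectiveValue, lotterySurplus_of_le hvp]
  ring

/-- A buyer with value `v ≤ p` gains nothing from Alice's lottery, so the second branch of the
effective tariff is of no use to him. -/
theorem effectiveValue_mul_le_of_le (hz : z ∈ Icc (0 : ℝ) 1) (hvp : v ≤ p) (hx : 0 ≤ x)
    (hBx : p * x ≤ (B x).toReal) : effectiveValue z p v * x ≤ effectiveTariff z p B x := by
  rw [effectiveValue_of_le hvp, effectiveTariff_of_ge hz.1 hBx]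
  nlinarith [mul_le_mul_of_nonneg_right hvp hx,
    mul_le_mul_of_nonneg_left hBx (sub_nonneg.2 hz.2)]

theorem IsChoice.effectiveUtility_le (hz : z ∈ Icc (0 : ℝ) 1) (hp : 0 ≤ p) (h0 : B 0 = 0)
    (hσ : IsChoice (singleLottery z p) B v σ) (hx : x ∈ Icc (0 : ℝ) 1) (hBx : B x ≠ ∞) :
    lotterySurplus z p v + (effectiveValue z p v * x - effectiveTariff z p B x) ≤
      utility (singleLottery z p) B v σ := by
  have hfeas : ∀ (o : Seller) {a : ℝ}, a ∈ Icc 0 z → Feasible (singleLottery z p) B ⟨o, a, x⟩ :=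
    fun o a ha => (feasible_singleLottery_iff hz.2).2 ⟨ha, hx, hBx⟩
  rcases le_total p v with hpv | hvp
  · rcases le_total (B x).toReal (z * p * x + (1 - z) * (B x).toReal) with h | h
    · rw [effectiveTariff, min_eq_left h, ← utility_bob_lottery hp hz.1 B hpv]
      exact hσ.utility_le (hfeas .bob (right_mem_Icc.2 hz.1))
    · rw [effectiveTariff, min_eq_right h, ← utility_alice_lottery hp hz.1 B hpv]
      exact hσ.utility_le (hfeas .alice (right_mem_Icc.2 hz.1))
  · rcases le_total (B x).toReal (p * x) with h | h
    · rw [effectiveTariff_of_le hz.1 h, ← utility_bob_no_lottery hp hz.1 B hvp]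
      exact hσ.utility_le (hfeas .bob (left_mem_Icc.2 hz.1))
    · rw [lotterySurplus_of_le hvp, zero_add]
      exact (sub_nonpos.2 (effectiveValue_mul_le_of_le hz hvp hx.1 h)).trans
        (hσ.utility_nonneg hz hp h0)

theorem utility_le_effectiveUtility (hz : z ∈ Icc (0 : ℝ) 1) (hp : 0 ≤ p)
    (hτ : Feasible (singleLottery z p) B τ) (hnonneg : 0 ≤ utility (singleLottery z p) B v τ) :
    utility (singleLottery z p) B v τ ≤
      lotterySurplus z p v + (effectiveValue z p v * τ.xB - effectiveTariff z p B τ.xB) := by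
  rw [feasible_singleLottery_iff hz.2] at hτ
  obtain ⟨o, a, x⟩ := τ
  obtain ⟨ha, hx, -⟩ := hτ
  simp only at ha hx ⊢
  have hleft : effectiveTariff z p B x ≤ (B x).toReal := min_le_left _ _
  have hright : effectiveTariff z p B x ≤ z * p * x + (1 - z) * (B x).toReal := min_le_right _ _
  rw [effectiveValue]
  cases o with
  | alice =>
    have ha1 : 0 ≤ 1 - a := sub_nonneg.2 (ha.2.trans hz.2)
    rw [utility_alice hp ha] at hnonneg ⊢
    rcases le_or_gt p v with hpv | hvp
    · rw [lotterySurplus_of_ge hpv]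
      rcases le_total (x * v - (B x).toReal) (v - p) with h | h
      · nlinarith [mul_le_mul_of_nonneg_right ha.2 (sub_nonneg.2 h)]
      · nlinarith [mul_le_mul_of_nonneg_left h ha.1,
          mul_nonneg (sub_nonneg.2 hx.2) (mul_nonneg hz.1 (sub_nonneg.2 hpv))]
    · have hsurplus : 0 ≤ x * v - (B x).toReal := by
        by_contra! hneg
        rcases ha.1.eq_or_lt with h | h
        · rw [← h] at hnonneg
          linarith
        · linarith [mul_neg_of_pos_of_neg h (sub_neg.2 hvp),
            mul_nonpos_of_nonneg_of_nonpos ha1 hneg.le]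
      rw [lotterySurplus_of_le hvp.le]
      nlinarith [mul_nonneg ha.1 (sub_nonneg.2 hvp.le), mul_nonneg ha.1 hsurplus]
  | bob =>
    have hsurplus : a * (v - p) ≤ lotterySurplus z p v :=
      (mul_le_mul_of_nonneg_left (le_max_left _ _) ha.1).trans
        (mul_le_mul_of_nonneg_right ha.2 (le_max_right _ _))
    rw [utility_bob hp ha]
    nlinarith [mul_le_mul_of_nonneg_left hsurplus (sub_nonneg.2 hx.2)]

theorem IsChoice.utility_eq (hz : z ∈ Icc (0 : ℝ) 1) (hp : 0 ≤ p) (h0 : B 0 = 0)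
    (hσ : IsChoice (singleLottery z p) B v σ) :
    utility (singleLottery z p) B v σ =
      lotterySurplus z p v + (effectiveValue z p v * σ.xB - effectiveTariff z p B σ.xB) :=
  (utility_le_effectiveUtility hz hp hσ.1 (hσ.utility_nonneg hz hp h0)).antisymm
    (hσ.effectiveUtility_le hz hp h0 hσ.1.2.1 hσ.1.2.2)

/-- The probability that a buyer with value `v` requests from Bob. -/
noncomputable def purchase (z p : ℝ) (B : Pricing) (v : ℝ) : ℝ :=
  (choice (singleLottery z p) B v).xB

theorem IsAdmissible.isDirectMechanism_purchase (hB : IsAdmissible (singleLottery z p) B)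
    (hz : z ∈ Icc (0 : ℝ) 1) (hp : 0 ≤ p) :
    IsDirectMechanism (effectiveValue z p) (purchase z p B)
      fun v => effectiveTariff z p B (purchase z p B v) where
  alloc_mem v := (hB.isChoice_choice v).1.2.1
  pay_nonneg v := effectiveTariff_nonneg hz hp (hB.isChoice_choice v).1.2.1.1
  rational v := by
    have hσ := hB.isChoice_choice v
    have hle := hσ.effectiveUtility_le hz hp hB.map_zero (left_mem_Icc.2 zero_le_one)
      (by simp [hB.map_zero])
    rw [hσ.utility_eq hz hp hB.map_zero, effectiveTariff_zero hB.map_zero] at hle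
    simp only [purchase]
    linarith
  truthful v w := by
    have hσ := hB.isChoice_choice v
    have hτ := (hB.isChoice_choice w).1.2
    have hle := hσ.effectiveUtility_le hz hp hB.map_zero hτ.1 hτ.2
    rw [hσ.utility_eq hz hp hB.map_zero] at hle
    exact le_of_add_le_add_left hle

/-- The lowest effective value of a buyer who requests at least the probability `y` from Bob; it
acts as the effective price of an infinitesimal unit of probability at the level `y`. -/
noncomputable def marginalPrice (z p : ℝ) (B : Pricing) : ℝ → ℝ≥0∞ :=
  thresholdPrice (effectiveValue z p) (purchase z p B)

theorem measurable_marginalPrice (z p : ℝ) (B : Pricing) : Measurable (marginalPrice z p B) :=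
  (monotone_thresholdPrice _ _).measurable

theorem IsAdmissible.lintegral_marginalPrice (hB : IsAdmissible (singleLottery z p) B)
    (hz : z ∈ Icc (0 : ℝ) 1) (hp : 0 ≤ p) (v : ℝ) :
    ∫⁻ y in Ioc 0 (purchase z p B v), marginalPrice z p B y =
      ENNReal.ofReal (effectiveTariff z p B (purchase z p B v)) :=
  (hB.isDirectMechanism_purchase hz hp).lintegral_thresholdPrice_eq (continuous_effectiveValue z p)
    (effectiveValue_of_le hp).le v

/-! ### Expensive purchases -/

theorem IsChoice.le_of_mul_lt (hz : z ∈ Icc (0 : ℝ) 1) (hp : 0 ≤ p) (h0 : B 0 = 0)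
    (hσ : IsChoice (singleLottery z p) B v σ) (hlt : p * σ.xB < (B σ.xB).toReal) : p ≤ v := by
  by_contra! hvp
  have hx : 0 < σ.xB := hσ.1.2.1.1.lt_of_ne fun h => by simp [← h, h0] at hlt
  have hnonneg := hσ.utility_nonneg hz hp h0
  rw [hσ.utility_eq hz hp h0, lotterySurplus_of_le hvp.le, effectiveValue_of_le hvp.le,
    effectiveTariff_of_ge hz.1 hlt.le] at hnonneg
  nlinarith [mul_lt_mul_of_pos_right hvp hx,
    mul_le_mul_of_nonneg_left hlt.le (sub_nonneg.2 hz.2)]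

theorem IsChoice.lottery_first (hz : z ∈ Icc (0 : ℝ) 1) (hp : 0 ≤ p) (h0 : B 0 = 0)
    (hσ : IsChoice (singleLottery z p) B v σ) (hlt : p * σ.xB < (B σ.xB).toReal) :
    z = 0 ∨ σ.first = .alice ∧ σ.xA = z := by
  have hpv := hσ.le_of_mul_lt hz hp h0 hlt
  have hfeas := (feasible_singleLottery_iff hz.2).1 hσ.1
  have hbest := hσ.utility_le ((feasible_singleLottery_iff hz.2).2
    ⟨right_mem_Icc.2 hz.1, hfeas.2⟩ : Feasible (singleLottery z p) B ⟨.alice, z, σ.xB⟩)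
  rw [utility_alice hp (right_mem_Icc.2 hz.1)] at hbest
  obtain ⟨o, a, x⟩ := σ
  obtain ⟨ha, hx, -⟩ := hfeas
  simp only at ha hx hlt hbest ⊢
  cases o with
  | alice =>
    rw [utility_alice hp ha] at hbest
    have hgain : 0 < (v - p) - (x * v - (B x).toReal) := by
      linarith [mul_nonneg (sub_nonneg.2 hx.2) (sub_nonneg.2 hpv)]
    exact .inr ⟨rfl, ha.2.antisymm (le_of_mul_le_mul_right (by linarith) hgain)⟩
  | bob =>
    rw [utility_bob hp ha] at hbest
    have hloss : z * ((B x).toReal - p * x) ≤ 0 := by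
      nlinarith [mul_le_mul_of_nonneg_left ha.2
        (mul_nonneg (sub_nonneg.2 hx.2) (sub_nonneg.2 hpv))]
    exact .inl ((nonpos_of_mul_nonpos_left hloss (sub_pos.2 hlt)).antisymm hz.1)

theorem payB_le (hσ : 0 ≤ σ.xA) : payB B σ ≤ B σ.xB := by
  obtain ⟨_ | _, a, x⟩ := σ
  · exact mul_le_of_le_one_left' (ENNReal.ofReal_le_one.2 (sub_le_self 1 hσ))
  · exact le_rfl

theorem IsChoice.payB_le_of_mul_lt (hz : z ∈ Icc (0 : ℝ) 1) (hp : 0 ≤ p) (h0 : B 0 = 0)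
    (hσ : IsChoice (singleLottery z p) B v σ) (hlt : p * σ.xB < (B σ.xB).toReal) :
    payB B σ ≤ ENNReal.ofReal (1 - z) * B σ.xB := by
  rcases hσ.lottery_first hz hp h0 hlt with rfl | ⟨hfirst, hxA⟩
  · simpa using payB_le hσ.1.1.1.1
  · simp [payB, hfirst, hxA]

theorem IsChoice.cheap_of_payA_lt (hz : z ∈ Icc (0 : ℝ) 1) (hp : 0 ≤ p) (h0 : B 0 = 0)
    (hσ : IsChoice (singleLottery z p) B v σ)
    (hpay : payA (singleLottery z p) σ < ENNReal.ofReal (p * z)) :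
    (B σ.xB).toReal ≤ p * σ.xB := by
  by_contra! hlt
  rcases hσ.lottery_first hz hp h0 hlt with rfl | ⟨hfirst, hxA⟩
  · simp at hpay
  · simp [payA, hfirst, hxA, singleLottery_of_le] at hpay

theorem IsChoice.xB_pos_of_payA_lt (hz : z ∈ Icc (0 : ℝ) 1) (hp : 0 ≤ p) (h0 : B 0 = 0)
    (hσ : IsChoice (singleLottery z p) B v σ) (hpv : p ≤ v)
    (hpay : payA (singleLottery z p) σ < ENNReal.ofReal (p * z)) : 0 < σ.xB := by
  refine hσ.1.2.1.1.lt_of_ne fun hx => hpay.not_ge ?_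
  have hzz : z ∈ Icc 0 z := right_mem_Icc.2 hz.1
  have hfeas := feasible_singleLottery_zero (p := p) hz h0 hzz .alice
  have hutility : utility (singleLottery z p) B v σ ≤
      utility (singleLottery z p) B v ⟨.alice, z, 0⟩ := by
    rw [hσ.utility_eq hz hp h0, ← hx, utility_alice_lottery hp hz.1 B hpv, h0,
      effectiveTariff_zero h0]
    simp
  have hallocB : allocB σ = 0 := by
    obtain ⟨_ | _, a, x⟩ := σ
    · exact mul_eq_zero_of_right _ hx.symm
    · exact hx.symm
  have hallocA := hσ.allocA_le hfeas hutility (by rw [hallocB]; simp [allocB])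
  have hxA : σ.xA ≤ z := ((feasible_singleLottery_iff hz.2).1 hσ.1).1.2
  have hxAz : σ.xA = z := by
    refine hxA.antisymm ?_
    obtain ⟨_ | _, a, x⟩ := σ
    · exact hallocA
    · simp only at hx
      subst hx
      simpa [allocA] using hallocA
  obtain ⟨_ | _, a, x⟩ := σ <;> simp only at hx hxAz <;>
    simp [payA, ← hx, hxAz, singleLottery_of_le]

/-! ### Fixed prices -/

theorem payB_fixedPrice (q : ℝ) (hσ : σ.xA ≤ 1) :
    payB (fixedPrice q) σ = ENNReal.ofReal (q * allocB σ) := by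
  obtain ⟨_ | _, a, x⟩ := σ
  · rw [payB, fixedPrice, allocB, ← ENNReal.ofReal_mul (sub_nonneg.2 hσ), mul_left_comm]
  · rfl

theorem toReal_fixedPrice {q : ℝ} (hq : 0 ≤ q) (hx : 0 ≤ x) : (fixedPrice q x).toReal = q * x :=
  ENNReal.toReal_ofReal (mul_nonneg hq hx)

theorem feasible_fixedPrice_one (hz : z ∈ Icc (0 : ℝ) 1) (q : ℝ) (o : Seller) :
    Feasible (singleLottery z p) (fixedPrice q) ⟨o, z, 1⟩ :=
  (feasible_singleLottery_iff hz.2).2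
    ⟨right_mem_Icc.2 hz.1, right_mem_Icc.2 zero_le_one, ENNReal.ofReal_ne_top⟩

theorem IsChoice.one_le_allocB_fixedPrice {q : ℝ} (hz : z ∈ Icc (0 : ℝ) 1) (hq : 0 ≤ q)
    (hqp : q ≤ p) (hqv : q ≤ v) (hσ : IsChoice (singleLottery z p) (fixedPrice q) v σ) :
    1 ≤ allocB σ := by
  have hp : 0 ≤ p := hq.trans hqp
  have hx : σ.xB ∈ Icc (0 : ℝ) 1 := hσ.1.2.1
  have hcheap : (fixedPrice q σ.xB).toReal ≤ p * σ.xB := by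
    rw [toReal_fixedPrice hq hx.1]
    exact mul_le_mul_of_nonneg_right hqp hx.1
  refine hσ.allocB_le (feasible_fixedPrice_one hz q .bob) ?_
  rw [hσ.utility_eq hz hp (by simp [fixedPrice]), effectiveTariff_of_le hz.1 hcheap,
    utility_bob hp (right_mem_Icc.2 hz.1), toReal_fixedPrice hq hx.1,
    toReal_fixedPrice hq zero_le_one, effectiveValue]
  have hgain := mul_nonneg (sub_nonneg.2 hx.2) (sub_nonneg.2 (le_effectiveValue hz hqp hqv))
  rw [effectiveValue] at hgain
  linarith

theorem IsChoice.one_sub_le_allocB_fixedPrice {q : ℝ} (hz : z ∈ Icc (0 : ℝ) 1) (hp : 0 ≤ p)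
    (hpq : p ≤ q) (hqv : q ≤ v) (hσ : IsChoice (singleLottery z p) (fixedPrice q) v σ) :
    1 - z ≤ allocB σ := by
  have hq : 0 ≤ q := hp.trans hpq
  have hx : σ.xB ∈ Icc (0 : ℝ) 1 := hσ.1.2.1
  have hexpensive : p * σ.xB ≤ (fixedPrice q σ.xB).toReal := by
    rw [toReal_fixedPrice hq hx.1]
    exact mul_le_mul_of_nonneg_right hpq hx.1
  refine (mul_one (1 - z)).ge.trans (hσ.allocB_le (feasible_fixedPrice_one hz q .alice) ?_)
  rw [hσ.utility_eq hz hp (by simp [fixedPrice]), effectiveTariff_of_ge hz.1 hexpensive,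
    utility_alice hp (right_mem_Icc.2 hz.1), toReal_fixedPrice hq hx.1,
    toReal_fixedPrice hq zero_le_one, lotterySurplus_of_ge (hpq.trans hqv),
    effectiveValue_of_ge (hpq.trans hqv)]
  linarith [mul_nonneg (mul_nonneg (sub_nonneg.2 hz.2) (sub_nonneg.2 hqv)) (sub_nonneg.2 hx.2)]

theorem mul_revenueCurve_le_revB_fixedPrice (hD : IsValueDistribution D f)
    (hz : z ∈ Icc (0 : ℝ) 1) (hp : 0 ≤ p) {q c : ℝ} (hq : 0 ≤ q) (hc : 0 ≤ c)
    (h : ∀ v σ, q ≤ v → IsChoice (singleLottery z p) (fixedPrice q) v σ → c ≤ allocB σ) :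
    ENNReal.ofReal (c * revenueCurve D q) ≤ revB (singleLottery z p) (fixedPrice q) D :=
  calc ENNReal.ofReal (c * revenueCurve D q)
      = ∫⁻ _ in Ici q, ENNReal.ofReal (q * c) ∂D := by
        rw [setLIntegral_const, hD.measure_Ici, ← ENNReal.ofReal_mul (mul_nonneg hq hc),
          revenueCurve, mul_left_comm, mul_assoc]
    _ ≤ ∫⁻ v in Ici q, payB (fixedPrice q) (choice (singleLottery z p) (fixedPrice q) v) ∂D := by
        refine setLIntegral_mono' measurableSet_Ici fun v hv => ?_
        have hσ := (isAdmissible_fixedPrice hz hp q).isChoice_choice v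
        rw [payB_fixedPrice q hσ.1.1.1.2]
        exact ENNReal.ofReal_le_ofReal (mul_le_mul_of_nonneg_left (h v _ hv hσ) hq)
    _ ≤ revB (singleLottery z p) (fixedPrice q) D := setLIntegral_le_lintegral _ _

theorem revenueCurve_le_revB_fixedPrice (hD : IsValueDistribution D f) (hz : z ∈ Icc (0 : ℝ) 1)
    {q : ℝ} (hq : 0 ≤ q) (hqp : q ≤ p) :
    ENNReal.ofReal (revenueCurve D q) ≤ revB (singleLottery z p) (fixedPrice q) D := by
  simpa only [one_mul] using mul_revenueCurve_le_revB_fixedPrice hD hz (hq.trans hqp) hq zero_le_one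
    fun _ _ hqv hσ => hσ.one_le_allocB_fixedPrice hz hq hqp hqv

theorem one_sub_mul_revenueCurve_le_revB_fixedPrice (hD : IsValueDistribution D f)
    (hz : z ∈ Icc (0 : ℝ) 1) (hp : 0 ≤ p) {q : ℝ} (hpq : p ≤ q) :
    ENNReal.ofReal ((1 - z) * revenueCurve D q) ≤ revB (singleLottery z p) (fixedPrice q) D :=
  mul_revenueCurve_le_revB_fixedPrice hD hz hp (hp.trans hpq) (sub_nonneg.2 hz.2)
    fun _ _ hqv hσ => hσ.one_sub_le_allocB_fixedPrice hz hp hpq hqv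

/-! ### Upper bounds for the revenue -/

/-- The probabilities bought from Bob by some type at an average price of at most `p`. -/
def cheapPurchases (z p : ℝ) (B : Pricing) : Set ℝ :=
  {x ∈ range (purchase z p B) | (B x).toReal ≤ p * x}

/-- The largest probability bought from Bob at an average price of at most `p`. -/
noncomputable def cheapLevel (z p : ℝ) (B : Pricing) : ℝ := sSup (cheapPurchases z p B)

namespace IsAdmissible

theorem cheapPurchases_subset (hB : IsAdmissible (singleLottery z p) B) :
    cheapPurchases z p B ⊆ Icc 0 1 := by
  rintro _ ⟨⟨v, rfl⟩, -⟩
  exact (hB.isChoice_choice v).1.2.1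

theorem nonempty_cheapPurchases (hB : IsAdmissible (singleLottery z p) B)
    (hz : z ∈ Icc (0 : ℝ) 1) (hp : 0 ≤ p) : (cheapPurchases z p B).Nonempty :=
  ⟨_, mem_range_self (p - 1), not_lt.1 fun hlt => (sub_one_lt p).not_ge
    ((hB.isChoice_choice (p - 1)).le_of_mul_lt hz hp hB.map_zero hlt)⟩

theorem le_cheapLevel (hB : IsAdmissible (singleLottery z p) B)
    (hx : x ∈ cheapPurchases z p B) : x ≤ cheapLevel z p B :=
  le_csSup (bddAbove_Icc.mono hB.cheapPurchases_subset) hx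

theorem cheapLevel_mem (hB : IsAdmissible (singleLottery z p) B) (hz : z ∈ Icc (0 : ℝ) 1)
    (hp : 0 ≤ p) : cheapLevel z p B ∈ Icc (0 : ℝ) 1 := by
  obtain ⟨x, hx⟩ := hB.nonempty_cheapPurchases hz hp
  exact ⟨(hB.cheapPurchases_subset hx).1.trans (hB.le_cheapLevel hx),
    csSup_le ⟨x, hx⟩ fun y hy => (hB.cheapPurchases_subset hy).2⟩

theorem lintegral_marginalPrice_cheapLevel_le (hB : IsAdmissible (singleLottery z p) B)
    (hz : z ∈ Icc (0 : ℝ) 1) (hp : 0 ≤ p) :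
    ∫⁻ y in Ioc 0 (cheapLevel z p B), marginalPrice z p B y ≤
      ENNReal.ofReal (p * cheapLevel z p B) := by
  refine setLIntegral_Ioc_le_of_forall_lt fun b hb => ?_
  obtain ⟨_, hx, hbx⟩ := exists_lt_of_lt_csSup (hB.nonempty_cheapPurchases hz hp) hb
  obtain ⟨⟨v, rfl⟩, hcheap⟩ := id hx
  calc ∫⁻ y in Ioc 0 b, marginalPrice z p B y
      ≤ ∫⁻ y in Ioc 0 (purchase z p B v), marginalPrice z p B y :=
        lintegral_mono_set (Ioc_subset_Ioc_right hbx.le)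
    _ = ENNReal.ofReal (B (purchase z p B v)).toReal := by
        rw [hB.lintegral_marginalPrice hz hp, effectiveTariff_of_le hz.1 hcheap]
    _ ≤ ENNReal.ofReal (p * cheapLevel z p B) := ENNReal.ofReal_le_ofReal
        (hcheap.trans (mul_le_mul_of_nonneg_left (hB.le_cheapLevel hx) hp))

theorem le_marginalPrice_of_cheapLevel_lt (hB : IsAdmissible (singleLottery z p) B)
    (hz : z ∈ Icc (0 : ℝ) 1) (hp : 0 ≤ p) {y : ℝ} (hy : cheapLevel z p B < y) :
    ENNReal.ofReal p ≤ marginalPrice z p B y := by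
  refine le_iInf₂ fun v hv => ENNReal.ofReal_le_ofReal (le_effectiveValue hz le_rfl ?_)
  have hexpensive : p * purchase z p B v < (B (purchase z p B v)).toReal := by
    by_contra! hcheap
    exact (hy.trans_le hv).not_ge (hB.le_cheapLevel ⟨mem_range_self v, hcheap⟩)
  exact (hB.isChoice_choice v).le_of_mul_lt hz hp hB.map_zero hexpensive

end IsAdmissible

/-- The payment to Bob for an infinitesimal unit of probability at the level `y`. Above the cheap
level the buyer plays Alice's lottery first, and Bob gets the effective price without the share
`z * p` that accounts for her. -/
noncomputable def marginalPay (z p : ℝ) (B : Pricing) (y : ℝ) : ℝ≥0∞ :=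
  if y ≤ cheapLevel z p B then marginalPrice z p B y
  else marginalPrice z p B y - ENNReal.ofReal (z * p)

theorem measurable_marginalPay (z p : ℝ) (B : Pricing) : Measurable (marginalPay z p B) :=
  Measurable.ite measurableSet_Iic (measurable_marginalPrice z p B)
    ((measurable_marginalPrice z p B).sub_const _)

theorem marginalPay_le_marginalPrice (z p : ℝ) (B : Pricing) (y : ℝ) :
    marginalPay z p B y ≤ marginalPrice z p B y := by
  unfold marginalPay
  split_ifs
  exacts [le_rfl, tsub_le_self]

theorem marginalPrice_sub_le_marginalPay (z p : ℝ) (B : Pricing) (y : ℝ) :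
    marginalPrice z p B y - ENNReal.ofReal (z * p) ≤ marginalPay z p B y := by
  unfold marginalPay
  split_ifs
  exacts [tsub_le_self, le_rfl]

namespace IsAdmissible

theorem payB_le_of_cheap (hB : IsAdmissible (singleLottery z p) B)
    (hz : z ∈ Icc (0 : ℝ) 1) (hp : 0 ≤ p)
    (hcheap : (B (purchase z p B v)).toReal ≤ p * purchase z p B v) :
    payB B (choice (singleLottery z p) B v) ≤
      ∫⁻ y in Ioc 0 (purchase z p B v), marginalPay z p B y := by
  have hσ := hB.isChoice_choice v
  calc payB B (choice (singleLottery z p) B v)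
      ≤ B (purchase z p B v) := payB_le hσ.1.1.1.1
    _ = ∫⁻ y in Ioc 0 (purchase z p B v), marginalPrice z p B y := by
        rw [hB.lintegral_marginalPrice hz hp, effectiveTariff_of_le hz.1 hcheap,
          ENNReal.ofReal_toReal (show B (purchase z p B v) ≠ ∞ from hσ.1.2.2)]
    _ = ∫⁻ y in Ioc 0 (purchase z p B v), marginalPay z p B y :=
        setLIntegral_congr_fun measurableSet_Ioc fun y hy =>
          (if_pos (hy.2.trans (hB.le_cheapLevel ⟨mem_range_self v, hcheap⟩))).symm

theorem payB_le_of_expensive (hB : IsAdmissible (singleLottery z p) B)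
    (hz : z ∈ Icc (0 : ℝ) 1) (hp : 0 ≤ p)
    (hexpensive : p * purchase z p B v < (B (purchase z p B v)).toReal) :
    payB B (choice (singleLottery z p) B v) ≤
      ∫⁻ y in Ioc 0 (purchase z p B v), marginalPay z p B y := by
  have hσ := hB.isChoice_choice v
  have hx : 0 ≤ purchase z p B v := hσ.1.2.1.1
  have hzp : 0 ≤ z * p := mul_nonneg hz.1 hp
  calc payB B (choice (singleLottery z p) B v)
      ≤ ENNReal.ofReal (1 - z) * B (purchase z p B v) :=
        hσ.payB_le_of_mul_lt hz hp hB.map_zero hexpensive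
    _ = ENNReal.ofReal (effectiveTariff z p B (purchase z p B v)) -
          ENNReal.ofReal (z * p * purchase z p B v) := by
        rw [effectiveTariff_of_ge hz.1 hexpensive.le, ← ENNReal.ofReal_sub _ (mul_nonneg hzp hx),
          add_sub_cancel_left, ENNReal.ofReal_mul (sub_nonneg.2 hz.2),
          ENNReal.ofReal_toReal (show B (purchase z p B v) ≠ ∞ from hσ.1.2.2)]
    _ = (∫⁻ y in Ioc 0 (purchase z p B v), marginalPrice z p B y) -
          ∫⁻ _ in Ioc 0 (purchase z p B v), ENNReal.ofReal (z * p) := by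
        rw [hB.lintegral_marginalPrice hz hp, setLIntegral_const, Real.volume_Ioc, sub_zero,
          ENNReal.ofReal_mul hzp]
    _ ≤ ∫⁻ y in Ioc 0 (purchase z p B v), (marginalPrice z p B y - ENNReal.ofReal (z * p)) :=
        lintegral_sub_le _ _ measurable_const
    _ ≤ ∫⁻ y in Ioc 0 (purchase z p B v), marginalPay z p B y :=
        lintegral_mono (marginalPrice_sub_le_marginalPay z p B)

theorem revB_le_lintegral (hB : IsAdmissible (singleLottery z p) B)
    (hD : IsValueDistribution D f) (hz : z ∈ Icc (0 : ℝ) 1) (hp : 0 ≤ p) :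
    revB (singleLottery z p) B D ≤
      ∫⁻ y in Ioc 0 1, marginalPay z p B y * effectiveDemand D z p (marginalPrice z p B y) := by
  have := hD.isProbabilityMeasure
  exact lintegral_le_lintegral_mul_demand D (continuous_effectiveValue z p).measurable
    (fun v => (hB.isChoice_choice v).1.2.1.2) (measurable_marginalPay z p B)
    fun _ => (le_or_gt _ _).elim (hB.payB_le_of_cheap hz hp) (hB.payB_le_of_expensive hz hp)

theorem revB_le_revenueCurve (hB : IsAdmissible (singleLottery z p) B)
    (hD : IsValueDistribution D f) (hv : IsMyersonPrice D v) (hz : z ∈ Icc (0 : ℝ) 1)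
    (hp : 0 ≤ p) :
    revB (singleLottery z p) B D ≤ ENNReal.ofReal (revenueCurve D v) :=
  calc revB (singleLottery z p) B D
      ≤ ∫⁻ y in Ioc 0 1, marginalPay z p B y * effectiveDemand D z p (marginalPrice z p B y) :=
        hB.revB_le_lintegral hD hz hp
    _ ≤ ∫⁻ _ in Ioc (0 : ℝ) 1, ENNReal.ofReal (revenueCurve D v) :=
        lintegral_mono fun y => (mul_le_mul_left (marginalPay_le_marginalPrice z p B y) _).trans
          (hv.mul_effectiveDemand_le hD hz.1 p _)
    _ = ENNReal.ofReal (revenueCurve D v) := by simp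

theorem lintegral_cheap_le {l : ℝ} (hB : IsAdmissible (singleLottery z p) B)
    (hD : IsValueDistribution D f) (hl : IsSupportingSlope D p l) (hz : z ∈ Icc (0 : ℝ) 1)
    (hp : 0 ≤ p) :
    ∫⁻ y in Ioc 0 (cheapLevel z p B),
        marginalPay z p B y * effectiveDemand D z p (marginalPrice z p B y) ≤
      ENNReal.ofReal (cheapLevel z p B * revenueCurve D p) := by
  have hintercept : 0 ≤ revenueCurve D p - l * p := by
    simpa [revenueCurve] using hl.le 0 le_rfl
  have hX : 0 ≤ cheapLevel z p B := (hB.cheapLevel_mem hz hp).1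
  have hint := hB.lintegral_marginalPrice_cheapLevel_le hz hp
  generalize cheapLevel z p B = X at hX hint ⊢
  calc ∫⁻ y in Ioc 0 X, marginalPay z p B y * effectiveDemand D z p (marginalPrice z p B y)
      ≤ ∫⁻ y in Ioc 0 X,
          (ENNReal.ofReal (revenueCurve D p - l * p) + ENNReal.ofReal l * marginalPrice z p B y) :=
        lintegral_mono fun y => (mul_le_mul_left (marginalPay_le_marginalPrice z p B y) _).trans
          (hl.mul_effectiveDemand_le hD hz hp _)
    _ = ENNReal.ofReal (revenueCurve D p - l * p) * ENNReal.ofReal X +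
          ENNReal.ofReal l * ∫⁻ y in Ioc 0 X, marginalPrice z p B y := by
        rw [lintegral_add_left measurable_const,
          lintegral_const_mul _ (measurable_marginalPrice z p B), setLIntegral_const,
          Real.volume_Ioc, sub_zero]
    _ ≤ ENNReal.ofReal (revenueCurve D p - l * p) * ENNReal.ofReal X +
          ENNReal.ofReal l * ENNReal.ofReal (p * X) := by gcongr
    _ = ENNReal.ofReal (X * revenueCurve D p) := by
        rw [← ENNReal.ofReal_mul hintercept, ← ENNReal.ofReal_mul hl.nonneg,
          ← ENNReal.ofReal_add (mul_nonneg hintercept hX)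
            (mul_nonneg hl.nonneg (mul_nonneg hp hX))]
        ring_nf

theorem lintegral_expensive_le (hB : IsAdmissible (singleLottery z p) B)
    (hD : IsValueDistribution D f) (hv : IsMyersonPrice D v) (hz : z ∈ Icc (0 : ℝ) 1)
    (hp : 0 ≤ p) :
    ∫⁻ y in Ioc (cheapLevel z p B) 1,
        marginalPay z p B y * effectiveDemand D z p (marginalPrice z p B y) ≤
      ENNReal.ofReal ((1 - cheapLevel z p B) * ((1 - z) * revenueCurve D v)) :=
  calc ∫⁻ y in Ioc (cheapLevel z p B) 1,
        marginalPay z p B y * effectiveDemand D z p (marginalPrice z p B y)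
      ≤ ∫⁻ _ in Ioc (cheapLevel z p B) 1, ENNReal.ofReal ((1 - z) * revenueCurve D v) := by
        refine setLIntegral_mono measurable_const fun y hy => ?_
        rw [marginalPay, if_neg hy.1.not_ge]
        exact hv.sub_mul_effectiveDemand_le hD hz hp
          (hB.le_marginalPrice_of_cheapLevel_lt hz hp hy.1)
    _ = ENNReal.ofReal ((1 - cheapLevel z p B) * ((1 - z) * revenueCurve D v)) := by
        rw [setLIntegral_const, Real.volume_Ioc, mul_comm,
          ENNReal.ofReal_mul (sub_nonneg.2 (hB.cheapLevel_mem hz hp).2)]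

theorem revB_le_convexCombination {l : ℝ} (hB : IsAdmissible (singleLottery z p) B)
    (hD : IsValueDistribution D f) (hl : IsSupportingSlope D p l) (hv : IsMyersonPrice D v)
    (hz : z ∈ Icc (0 : ℝ) 1) (hp : 0 ≤ p) :
    revB (singleLottery z p) B D ≤ ENNReal.ofReal (cheapLevel z p B * revenueCurve D p +
      (1 - cheapLevel z p B) * ((1 - z) * revenueCurve D v)) := by
  have hX := hB.cheapLevel_mem hz hp
  refine (hB.revB_le_lintegral hD hz hp).trans ?_
  rw [← Ioc_union_Ioc_eq_Ioc hX.1 hX.2,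
    lintegral_union measurableSet_Ioc (Ioc_disjoint_Ioc_of_le le_rfl),
    ENNReal.ofReal_add (mul_nonneg hX.1 (revenueCurve_nonneg D hp))
      (mul_nonneg (sub_nonneg.2 hX.2)
        (mul_nonneg (sub_nonneg.2 hz.2) (revenueCurve_nonneg D hv.1)))]
  exact add_le_add (hB.lintegral_cheap_le hD hl hz hp) (hB.lintegral_expensive_le hD hv hz hp)

theorem cheapLevel_pos (hB : IsAdmissible (singleLottery z p) B) (hz : z ∈ Icc (0 : ℝ) 1)
    (hp : 0 ≤ p) (hpv : p ≤ v)
    (hpay : payA (singleLottery z p) (choice (singleLottery z p) B v) < ENNReal.ofReal (p * z)) :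
    0 < cheapLevel z p B :=
  have hσ := hB.isChoice_choice v
  (hσ.xB_pos_of_payA_lt hz hp hB.map_zero hpv hpay).trans_le
    (hB.le_cheapLevel ⟨mem_range_self v, hσ.cheap_of_payA_lt hz hp hB.map_zero hpay⟩)

end IsAdmissible

end Choice

/-! ### Optimal fixed prices -/

/-- Posting the price `q ≤ p` is a best response of Bob to the single-lottery mechanism with
probability `z` and price `p`. -/
structure IsLowBestResponse (D : Measure ℝ) (z p q : ℝ) : Prop where
  mem_Icc : q ∈ Icc 0 p
  revB_le : ∀ B, IsAdmissible (singleLottery z p) B →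
    revB (singleLottery z p) B D ≤ revB (singleLottery z p) (fixedPrice q) D

theorem IsMyersonPrice.isLowBestResponse {q : ℝ} (hq : IsMyersonPrice D q)
    (hD : IsValueDistribution D f) (hz : z ∈ Icc (0 : ℝ) 1) (hqp : q ≤ p) :
    IsLowBestResponse D z p q :=
  ⟨⟨hq.1, hqp⟩, fun _ hB => (hB.revB_le_revenueCurve hD hq hz (hq.1.trans hqp)).trans
    (revenueCurve_le_revB_fixedPrice hD hz hq.1 hqp)⟩

theorem IsSupportingSlope.isLowBestResponse {l : ℝ} (hl : IsSupportingSlope D p l)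
    (hD : IsValueDistribution D f) (hv : IsMyersonPrice D v) (hz : z ∈ Icc (0 : ℝ) 1)
    (hp : 0 ≤ p) (hle : (1 - z) * revenueCurve D v ≤ revenueCurve D p) :
    IsLowBestResponse D z p p := by
  refine ⟨⟨hp, le_rfl⟩, fun B hB => ?_⟩
  have hX := hB.cheapLevel_mem hz hp
  calc revB (singleLottery z p) B D
      ≤ ENNReal.ofReal (cheapLevel z p B * revenueCurve D p +
          (1 - cheapLevel z p B) * ((1 - z) * revenueCurve D v)) :=
        hB.revB_le_convexCombination hD hl hv hz hp
    _ ≤ ENNReal.ofReal (revenueCurve D p) := ENNReal.ofReal_le_ofReal <| by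
        linarith [mul_le_mul_of_nonneg_left hle (sub_nonneg.2 hX.2)]
    _ ≤ revB (singleLottery z p) (fixedPrice p) D :=
        revenueCurve_le_revB_fixedPrice hD hz hp le_rfl

theorem exists_isLowBestResponse_or (hD : IsValueDistribution D f)
    (hreg : IsRegular D f ∨ IsDMR D f) (hv : IsMyersonPrice D v) (hz : z ∈ Icc (0 : ℝ) 1)
    (hp : 0 ≤ p) :
    (∃ q, IsLowBestResponse D z p q) ∨
      p ≤ v ∧ revenueCurve D p < (1 - z) * revenueCurve D v ∧ ∃ l, IsSupportingSlope D p l := by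
  rcases le_total v p with hvp | hpv
  · exact .inl ⟨v, hv.isLowBestResponse hD hz hvp⟩
  have hmax : revenueCurve D p ≤ revenueCurve D v := hv.2 hp
  rcases hmax.eq_or_lt with heq | hlt
  · have hpM : IsMyersonPrice D p := ⟨hp, fun t ht => (hv.2 ht).trans heq.ge⟩
    exact .inl ⟨p, hpM.isLowBestResponse hD hz le_rfl⟩
  obtain ⟨l, hl⟩ := hD.exists_isSupportingSlope hreg hp hpv hlt
  rcases le_or_gt ((1 - z) * revenueCurve D v) (revenueCurve D p) with hle | hgt
  · exact .inl ⟨p, hl.isLowBestResponse hD hv hz hp hle⟩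
  · exact .inr ⟨hpv, hgt, l, hl⟩

theorem IsAdmissible.revB_le_revB_fixedPrice {B : Pricing} {l : ℝ}
    (hB : IsAdmissible (singleLottery z p) B) (hD : IsValueDistribution D f)
    (hl : IsSupportingSlope D p l) (hv : IsMyersonPrice D v) (hz : z ∈ Icc (0 : ℝ) 1) (hp : 0 ≤ p)
    (hpv : p ≤ v) (hle : revenueCurve D p ≤ (1 - z) * revenueCurve D v) :
    revB (singleLottery z p) B D ≤ revB (singleLottery z p) (fixedPrice v) D :=
  calc revB (singleLottery z p) B D
      ≤ ENNReal.ofReal (cheapLevel z p B * revenueCurve D p +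
          (1 - cheapLevel z p B) * ((1 - z) * revenueCurve D v)) :=
        hB.revB_le_convexCombination hD hl hv hz hp
    _ ≤ ENNReal.ofReal ((1 - z) * revenueCurve D v) := ENNReal.ofReal_le_ofReal <| by
        linarith [mul_le_mul_of_nonneg_left hle (hB.cheapLevel_mem hz hp).1]
    _ ≤ revB (singleLottery z p) (fixedPrice v) D :=
        one_sub_mul_revenueCurve_le_revB_fixedPrice hD hz hp hpv

theorem IsAdmissible.revB_lt_revB_fixedPrice {B : Pricing} {l : ℝ}
    (hB : IsAdmissible (singleLottery z p) B) (hD : IsValueDistribution D f)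
    (hl : IsSupportingSlope D p l) (hv : IsMyersonPrice D v) (hz : z ∈ Icc (0 : ℝ) 1) (hp : 0 ≤ p)
    (hpv : p ≤ v) (hlt : revenueCurve D p < (1 - z) * revenueCurve D v)
    (hX : 0 < cheapLevel z p B) :
    revB (singleLottery z p) B D < revB (singleLottery z p) (fixedPrice v) D :=
  calc revB (singleLottery z p) B D
      ≤ ENNReal.ofReal (cheapLevel z p B * revenueCurve D p +
          (1 - cheapLevel z p B) * ((1 - z) * revenueCurve D v)) :=
        hB.revB_le_convexCombination hD hl hv hz hp
    _ < ENNReal.ofReal ((1 - z) * revenueCurve D v) :=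
        (ENNReal.ofReal_lt_ofReal_iff ((revenueCurve_nonneg D hp).trans_lt hlt)).2 <| by
          linarith [mul_lt_mul_of_pos_left hlt hX]
    _ ≤ revB (singleLottery z p) (fixedPrice v) D :=
        one_sub_mul_revenueCurve_le_revB_fixedPrice hD hz hp hpv

end Duopoly

theorem lemma3p2_general (D : MeasureTheory.Measure ℝ) (f : ℝ → ℝ)
    (hD : Duopoly.IsValueDistribution D f)
    (hreg : Duopoly.IsRegular D f ∨ Duopoly.IsDMR D f)
    (vM : ℝ) (hvM : Duopoly.IsMyersonPrice D vM)
    (z p : ℝ) (hz : z ∈ Set.Icc (0 : ℝ) 1) (hp : 0 ≤ p)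
    (B : Duopoly.Pricing) (hB : Duopoly.IsAdmissible (Duopoly.singleLottery z p) B) :
    ∃ q : ℝ, 0 ≤ q ∧
      Duopoly.revB (Duopoly.singleLottery z p) B D ≤
        Duopoly.revB (Duopoly.singleLottery z p) (Duopoly.fixedPrice q) D ∧
      ((∀ p' ∈ Set.Icc 0 p,
          Duopoly.revB (Duopoly.singleLottery z p) (Duopoly.fixedPrice p') D <
            Duopoly.revB (Duopoly.singleLottery z p) (Duopoly.fixedPrice vM) D) →
        (∃ v : ℝ, p ≤ v ∧
          Duopoly.payA (Duopoly.singleLottery z p)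
            (Duopoly.choice (Duopoly.singleLottery z p) B v) < ENNReal.ofReal (p * z)) →
        Duopoly.revB (Duopoly.singleLottery z p) B D <
          Duopoly.revB (Duopoly.singleLottery z p) (Duopoly.fixedPrice q) D) := by
  rcases Duopoly.exists_isLowBestResponse_or hD hreg hvM hz hp with ⟨q, hq⟩ | ⟨hpv, hlt, l, hl⟩
  · refine ⟨q, hq.mem_Icc.1, hq.revB_le B hB, fun hstrict => ?_⟩
    have hbest := hq.revB_le _ (Duopoly.isAdmissible_fixedPrice hz hp vM)
    exact absurd (hstrict q hq.mem_Icc) hbest.not_gt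
  · refine ⟨vM, hvM.1, hB.revB_le_revB_fixedPrice hD hl hvM hz hp hpv hlt.le, ?_⟩
    rintro - ⟨v, hv, hpay⟩
    exact hB.revB_lt_revB_fixedPrice hD hl hvM hz hp hpv hlt (hB.cheapLevel_pos hz hp hv hpay)

theorem lemma3p2 (D : MeasureTheory.Measure ℝ) (f : ℝ → ℝ)
    (hD : Duopoly.IsValueDistribution D f)
    (hreg : Duopoly.IsRegular D f ∨ Duopoly.IsDMR D f)
    (vM : ℝ) (hvM : Duopoly.IsMyersonPrice D vM)
    (z p : ℝ) (hz : z ∈ Set.Icc (0 : ℝ) 1) (hp : 0 ≤ p)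
    (B : Duopoly.Pricing) (hB : Duopoly.IsProper B) :
    ∃ q : ℝ, 0 ≤ q ∧
      Duopoly.revB (Duopoly.singleLottery z p) B D ≤
        Duopoly.revB (Duopoly.singleLottery z p) (Duopoly.fixedPrice q) D ∧
      ((∀ p' ∈ Set.Icc 0 p,
          Duopoly.revB (Duopoly.singleLottery z p) (Duopoly.fixedPrice p') D <
            Duopoly.revB (Duopoly.singleLottery z p) (Duopoly.fixedPrice vM) D) →
        (∃ v : ℝ, p ≤ v ∧
          Duopoly.payA (Duopoly.singleLottery z p)
            (Duopoly.choice (Duopoly.singleLottery z p) B v) < ENNReal.ofReal (p * z)) →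
        Duopoly.revB (Duopoly.singleLottery z p) B D <
          Duopoly.revB (Duopoly.singleLottery z p) (Duopoly.fixedPrice q) D) :=
  lemma3p2_general D f hD hreg vM hvM z p hz hp B
    (Duopoly.isAdmissible_of_continuousOn hz hp hB.map_zero hB.continuousOn)
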